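/- Let $B$ be a category, and let $\mathsf{Fib}(B)$ be the 2-category whose objects are fibrations $f\colon A\to B$ equipped with a chosen cleavage (a chosen cartesian lift of every $\beta\colon b'\to f(a)$, not assumed normal or split; here $B$ is arbitrary and the total categories are small), whose 1-cells $(A,f)\to(C,g)$ are the functors $A\to C$ over $B$ that preserve the chosen cartesian lifts, and whose 2-cells are the natural transformations with components over identities of $B$. For $b\in B$ write $A_b$ for the fibre of $f$ over $b$, $p_b\colon A_b\to C_b$ for the restriction of a 1-cell $p$, and $\beta^*\colon A_b\to A_{b'}$ for the reindexing functor along $\beta\colon b'\to b$. A 1-cell $p$ is a fibrewise (discrete) opfibration if every $p_b$ is a (discrete) opfibration. In a 2-category: - the identee of $p\colon A\to C$ is the 2-universal 2-cell $\kappa\colon k_0\Rightarrow k_1\colon K\to A$ such that $p\kappa$ is an identity; - the coidentifier of a 2-cell $\alpha$ with codomain object $A$ is a 1-cell $q\colon A\to Q$ such that $q\alpha$ is an identity, every 1-cell $z$ with $z\alpha$ an identity is $z=tq$ for a unique $t$, and every 2-cell $\beta\colon tq\Rightarrow t'q$ is $\gamma q$ for a unique $\gamma\colon t\Rightarrow t'$;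 - $s\colon Q\to C$ is an (internal) discrete opfibration if composition with $s$ is a discrete opfibration $\mathrm{Hom}(X,Q)\to\mathrm{Hom}(X,C)$ for every object $X$; - a 1-cell is initial if it is left orthogonal, for 1-cells and for 2-cells, to all discrete opfibrations. **Proposition.** Every fibrewise opfibration $p\colon(A,f)\to(C,g)$ in $\mathsf{Fib}(B)$ has an identee $(K,\kappa)$ in $\mathsf{Fib}(B)$ and admits a comprehensive factorization $p=sq$ in $\mathsf{Fib}(B)$, $$(A,f)\xrightarrow{\;q\;}(Q,h)\xrightarrow{\;s\;}(C,g),$$ where $q$ is the coidentifier of $\kappa$ in $\mathsf{Fib}(B)$ and is initial in $\mathsf{Fib}(B)$, and $s$ is a discrete opfibration in $\mathsf{Fib}(B)$ and a fibrewise discrete opfibration. Moreover the coidentifier is computed fibrewise: for every $b\in B$, the restriction $\kappa_b$ is the identee of $p_b$ in $\mathsf{Cat}$ and $q_b$ is the coidentifier of $\kappa_b$ in $\mathsf{Cat}$ and an initial functor; and the fibres of $h$ are assembled by reindexing functors compatible with $q$ and $s$, that is, for every $\beta\colon b'\to b$ in $B$, $\beta^*q_b=q_{b'}\beta^*$ and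 $\beta^*s_b=s_{b'}\beta^*$. -/

import Mathlib

open CategoryTheory

/-! ## Notions in a 2-category

A 2-category is a strict bicategory. Composition is written in diagrammatic order:
`q ≫ s` is the composite usually denoted `s q`. -/

namespace TwoCat

universe w v u

section

variable {C : Type u} [Bicategory.{w, v} C] [Bicategory.Strict C]

open Bicategory

/-- The 2-cell `α : f ⟶ g` is an identity: `f = g` and `α` is the identity 2-cell. -/
def IsIdentity {X Y : C} {f g : X ⟶ Y} (α : f ⟶ g) : Prop :=
  ∃ h : f = g, α = eqToHom h

/-- `κ : k₀ ⟶ k₁ : K ⟶ A` is the identee of `p : A ⟶ D`: the 2-universal 2-cell whose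
whiskering with `p` is an identity. -/
structure IsIdentee {K A D : C} (p : A ⟶ D) {k₀ k₁ : K ⟶ A} (κ : k₀ ⟶ k₁) : Prop where
  isIdentity : IsIdentity (κ ▷ p)
  existsUnique_hom : ∀ {X : C} {x₀ x₁ : X ⟶ A} (ξ : x₀ ⟶ x₁), IsIdentity (ξ ▷ p) →
    ∃! t : X ⟶ K, ∃ (h₀ : t ≫ k₀ = x₀) (h₁ : t ≫ k₁ = x₁),
      t ◁ κ = eqToHom h₀ ≫ ξ ≫ eqToHom h₁.symm
  existsUnique_hom₂ : ∀ {X : C} {t t' : X ⟶ K} (α₀ : t ≫ k₀ ⟶ t' ≫ k₀)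
    (α₁ : t ≫ k₁ ⟶ t' ≫ k₁), t ◁ κ ≫ α₁ = α₀ ≫ t' ◁ κ →
      ∃! γ : t ⟶ t', γ ▷ k₀ = α₀ ∧ γ ▷ k₁ = α₁

/-- `q : A ⟶ Q` is the coidentifier of the 2-cell `α : f ⟶ g : X ⟶ A`. In the last clause,
the 1-cells `A ⟶ Z` that turn `α` into an identity are written as `q ≫ t`, which is no
restriction by the second clause. -/
structure IsCoidentifier {X A Q : C} {f g : X ⟶ A} (α : f ⟶ g) (q : A ⟶ Q) : Prop where
  isIdentity : IsIdentity (α ▷ q)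
  existsUnique_hom : ∀ {Z : C} (z : A ⟶ Z), IsIdentity (α ▷ z) → ∃! t : Q ⟶ Z, q ≫ t = z
  existsUnique_hom₂ : ∀ {Z : C} {t t' : Q ⟶ Z} (β : q ≫ t ⟶ q ≫ t'),
    ∃! γ : t ⟶ t', q ◁ γ = β

end

end TwoCat

namespace CategoryTheory.Functor

universe v₁ v₂ u₁ u₂

variable {X : Type u₁} {Y : Type u₂} [Category.{v₁} X] [Category.{v₂} Y]

/-- A functor is an opfibration if every arrow out of the image of an object has an opcartesian
lift at that object. -/
def IsOpfibration (p : X ⥤ Y) : Prop :=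
  ∀ (a : X) (S : Y) (f : p.obj a ⟶ S), ∃ (b : X) (φ : a ⟶ b), p.IsStronglyCocartesian f φ

/-- A functor is a discrete opfibration if every arrow out of the image of an object has
exactly one lift at that object. -/
def IsDiscreteOpfibration (p : X ⥤ Y) : Prop :=
  ∀ (a : X) (S : Y) (f : p.obj a ⟶ S), ∃! l : Σ b : X, a ⟶ b, p.IsHomLift f l.2

end CategoryTheory.Functor

namespace TwoCat

universe w v u

section

variable {C : Type u} [Bicategory.{w, v} C] [Bicategory.Strict C]

open Bicategory

/-- An internal discrete opfibration: composing with `s` is a discrete opfibration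
`C(X, E) ⥤ C(X, D)` for every `X`. (That precomposition with any `Y ⟶ X` preserves opcartesian
arrows is then automatic, since every arrow is opcartesian for a discrete opfibration.) -/
def IsDiscreteOpfibration {E D : C} (s : E ⟶ D) : Prop :=
  ∀ X : C, (postcomp X s).IsDiscreteOpfibration

/-- An initial 1-cell: one that is left orthogonal, in the 2-categorical sense, to all internal
discrete opfibrations. -/
structure IsInitial {A Q : C} (q : A ⟶ Q) : Prop where
  existsUnique_hom : ∀ {E D : C} (d : E ⟶ D), IsDiscreteOpfibration d →
    ∀ (a : A ⟶ E) (b : Q ⟶ D), a ≫ d = q ≫ b → ∃! t : Q ⟶ E, q ≫ t = a ∧ t ≫ d = b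
  existsUnique_hom₂ : ∀ {E D : C} (d : E ⟶ D), IsDiscreteOpfibration d →
    ∀ (t t' : Q ⟶ E) (α : q ≫ t ⟶ q ≫ t') (β : t ≫ d ⟶ t' ≫ d),
      α ▷ d ≫ (α_ q t' d).hom = (α_ q t d).hom ≫ q ◁ β →
        ∃! γ : t ⟶ t', q ◁ γ = α ∧ γ ▷ d = β

end

end TwoCat

/-! ## The 2-category of fibrations over a category -/

universe v₁ u₁ v₂ u₂

set_option linter.checkUnivs false in
/-- A fibration `p : obj ⥤ B` with a chosen cleavage: for each `β : R ⟶ S` in `B` and each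
object `a` over `S`, a chosen (strongly) cartesian arrow `lift β h : pull β h ⟶ a` over `β`.
The cleavage need not be normal nor split. -/
structure FibCat (B : Type u₁) [Category.{v₁} B] extends BasedCategory.{v₂, u₂} B where
  /-- The domain of the chosen cartesian lift. -/
  pull {R S : B} (β : R ⟶ S) {a : obj} (h : p.obj a = S) : obj
  /-- The chosen cartesian lift. -/
  lift {R S : B} (β : R ⟶ S) {a : obj} (h : p.obj a = S) : pull β h ⟶ a
  isStronglyCartesian_lift {R S : B} (β : R ⟶ S) {a : obj} (h : p.obj a = S) :
    p.IsStronglyCartesian β (lift β h)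

namespace FibCat

variable {B : Type u₁} [Category.{v₁} B]

instance (A : FibCat.{v₁, u₁, v₂, u₂} B) {R S : B} (β : R ⟶ S) {a : A.obj}
    (h : A.p.obj a = S) : A.p.IsStronglyCartesian β (A.lift β h) :=
  A.isStronglyCartesian_lift β h

/-- A morphism of cloven fibrations over `B`: a functor strictly over `B` that preserves the
chosen cartesian lifts. -/
structure Hom (A C : FibCat.{v₁, u₁, v₂, u₂} B) extends
    BasedFunctor A.toBasedCategory C.toBasedCategory where
  map_lift {R S : B} (β : R ⟶ S) {a : A.obj} (h : A.p.obj a = S) :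
    ∃ e : obj (A.pull β h) = C.pull β ((toBasedFunctor.w_obj a).trans h),
      map (A.lift β h) = eqToHom e ≫ C.lift β ((toBasedFunctor.w_obj a).trans h)

/-- 2-cells are the vertical natural transformations, i.e. those with components over identities
of `B`. -/
instance homCategory (A C : FibCat.{v₁, u₁, v₂, u₂} B) : Category (Hom A C) where
  Hom F G := F.toBasedFunctor ⟶ G.toBasedFunctor
  id F := 𝟙 F.toBasedFunctor
  comp α β := BasedNatTrans.comp α β

/-- The identity morphism. -/
def Hom.id (A : FibCat.{v₁, u₁, v₂, u₂} B) : Hom A A where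
  toBasedFunctor := BasedFunctor.id A.toBasedCategory
  map_lift _ _ _ := ⟨rfl, (Category.id_comp _).symm⟩

/-- The composite of two morphisms. -/
def Hom.comp {A C D : FibCat.{v₁, u₁, v₂, u₂} B} (F : Hom A C) (G : Hom C D) : Hom A D where
  toBasedFunctor := BasedFunctor.comp F.toBasedFunctor G.toBasedFunctor
  map_lift β a h := by
    obtain ⟨e, he⟩ := F.map_lift β h
    obtain ⟨e', he'⟩ := G.map_lift β ((F.w_obj _).trans h)
    refine ⟨(congrArg G.obj e).trans e', ?_⟩
    change G.map (F.map (A.lift β h)) = _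
    rw [he, G.map_comp, he', eqToHom_map, eqToHom_trans_assoc]
    rfl

/-- The 2-category `Fib(B)` of cloven fibrations over `B`, cleavage-preserving functors over `B`
and vertical natural transformations. -/
instance bicategory : Bicategory (FibCat.{v₁, u₁, v₂, u₂} B) where
  Hom A C := Hom A C
  id A := Hom.id A
  comp F G := Hom.comp F G
  homCategory A C := homCategory A C
  whiskerLeft F _ _ α := BasedCategory.whiskerLeft F.toBasedFunctor α
  whiskerRight α H := BasedCategory.whiskerRight α H.toBasedFunctor
  associator F G H := ⟨𝟙 (Hom.comp (Hom.comp F G) H), 𝟙 (Hom.comp (Hom.comp F G) H),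
    Category.id_comp _, Category.id_comp _⟩
  leftUnitor F := ⟨𝟙 F, 𝟙 F, Category.id_comp _, Category.id_comp _⟩
  rightUnitor F := ⟨𝟙 F, 𝟙 F, Category.id_comp _, Category.id_comp _⟩
  whiskerLeft_id F G :=
    Bicategory.whiskerLeft_id (B := BasedCategory.{v₂, u₂} B) F.toBasedFunctor G.toBasedFunctor
  whiskerLeft_comp F _ _ _ α β :=
    Bicategory.whiskerLeft_comp (B := BasedCategory.{v₂, u₂} B) F.toBasedFunctor α β
  id_whiskerLeft α := Bicategory.id_whiskerLeft (B := BasedCategory.{v₂, u₂} B) α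
  comp_whiskerLeft F G _ _ α :=
    Bicategory.comp_whiskerLeft (B := BasedCategory.{v₂, u₂} B) F.toBasedFunctor
      G.toBasedFunctor α
  id_whiskerRight F G :=
    Bicategory.id_whiskerRight (B := BasedCategory.{v₂, u₂} B) F.toBasedFunctor G.toBasedFunctor
  comp_whiskerRight α β F :=
    Bicategory.comp_whiskerRight (B := BasedCategory.{v₂, u₂} B) α β F.toBasedFunctor
  whiskerRight_id α := Bicategory.whiskerRight_id (B := BasedCategory.{v₂, u₂} B) α
  whiskerRight_comp α F G :=
    Bicategory.whiskerRight_comp (B := BasedCategory.{v₂, u₂} B) α F.toBasedFunctor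
      G.toBasedFunctor
  whisker_assoc F _ _ α G :=
    Bicategory.whisker_assoc (B := BasedCategory.{v₂, u₂} B) F.toBasedFunctor α
      G.toBasedFunctor
  whisker_exchange α β := Bicategory.whisker_exchange (B := BasedCategory.{v₂, u₂} B) α β
  pentagon F G H I :=
    Bicategory.pentagon (B := BasedCategory.{v₂, u₂} B) F.toBasedFunctor G.toBasedFunctor
      H.toBasedFunctor I.toBasedFunctor
  triangle F G :=
    Bicategory.triangle (B := BasedCategory.{v₂, u₂} B) F.toBasedFunctor G.toBasedFunctor

instance : Bicategory.Strict (FibCat.{v₁, u₁, v₂, u₂} B) where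

/-! ### Fibres -/

variable {A C : FibCat.{v₁, u₁, v₂, u₂} B}

/-- The fibre `A_b`, as an object of the 2-category of categories. -/
def fiber (A : FibCat.{v₁, u₁, v₂, u₂} B) (b : B) : Cat.{v₂, u₂} :=
  Cat.of (A.p.Fiber b)

/-- The restriction `F_b : A_b ⥤ C_b` of a morphism `F : A ⟶ C` to the fibres over `b`. -/
def fiberFunctor (F : Hom A C) (b : B) : A.p.Fiber b ⥤ C.p.Fiber b where
  obj x := ⟨F.obj x.1, (F.w_obj x.1).trans x.2⟩
  map φ := ⟨F.map φ.1, have := φ.2; inferInstance⟩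
  map_id x := Subtype.ext (F.map_id x.1)
  map_comp φ ψ := Subtype.ext (F.map_comp φ.1 ψ.1)

/-- The restriction `F_b`, as a 1-cell in the 2-category of categories. -/
def fiberHom (F : Hom A C) (b : B) : A.fiber b ⟶ C.fiber b :=
  (fiberFunctor F b).toCatHom

/-- The restriction `α_b : F_b ⟶ G_b` of a 2-cell `α : F ⟶ G` to the fibres over `b`. -/
def fiberHom₂ {F G : Hom A C} (α : F ⟶ G) (b : B) : fiberHom F b ⟶ fiberHom G b :=
  NatTrans.toCatHom₂
    { app := fun x => ⟨α.toNatTrans.app x.1, α.isHomLift x.2⟩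
      naturality := fun _ _ φ => Subtype.ext (α.toNatTrans.naturality φ.1) }

/-- The reindexing (change of base) functor `β^* : A_b ⥤ A_{b'}` along `β : b' ⟶ b` determined
by the cleavage. -/
noncomputable def reindex (A : FibCat.{v₁, u₁, v₂, u₂} B) {b' b : B} (β : b' ⟶ b) :
    A.p.Fiber b ⥤ A.p.Fiber b' where
  obj x := ⟨A.pull β x.2, IsHomLift.domain_eq A.p β (A.lift β x.2)⟩
  map {x y} φ :=
    haveI := φ.2
    ⟨Functor.IsCartesian.map A.p β (A.lift β y.2) (A.lift β x.2 ≫ φ.1), inferInstance⟩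
  map_id x := by
    have h₁ : A.p.IsHomLift (𝟙 b') (𝟙 (A.pull β x.2)) :=
      IsHomLift.id (IsHomLift.domain_eq A.p β (A.lift β x.2))
    have h₂ : A.p.IsHomLift β (A.lift β x.2 ≫ 𝟙 x.1) := by
      rw [Category.comp_id]; infer_instance
    exact Subtype.ext (Functor.IsCartesian.map_uniq A.p β (A.lift β x.2)
      (A.lift β x.2 ≫ 𝟙 x.1) (𝟙 (A.pull β x.2))
      ((Category.id_comp _).trans (Category.comp_id _).symm)).symm
  map_comp {x y z} φ ψ := by
    have h₁ := φ.2
    have h₂ := ψ.2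
    have h₃ : A.p.IsHomLift β (A.lift β x.2 ≫ φ.1 ≫ ψ.1) := inferInstance
    refine Subtype.ext (Functor.IsCartesian.map_uniq A.p β (A.lift β z.2)
      (A.lift β x.2 ≫ φ.1 ≫ ψ.1)
      (Functor.IsCartesian.map A.p β (A.lift β y.2) (A.lift β x.2 ≫ φ.1) ≫
        Functor.IsCartesian.map A.p β (A.lift β z.2) (A.lift β y.2 ≫ ψ.1)) ?_).symm
    rw [Category.assoc, Functor.IsCartesian.fac, Functor.IsCartesian.fac_assoc, Category.assoc]

/-- A fibrewise opfibration: a morphism of `Fib(B)` all of whose restrictions to fibres are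
opfibrations. -/
def IsFibrewiseOpfibration (p : Hom A C) : Prop :=
  ∀ b : B, (fiberFunctor p b).IsOpfibration

/-- A fibrewise discrete opfibration: a morphism of `Fib(B)` all of whose restrictions to fibres
are discrete opfibrations. -/
def IsFibrewiseDiscreteOpfibration (p : Hom A C) : Prop :=
  ∀ b : B, (fiberFunctor p b).IsDiscreteOpfibration

end FibCat

/-!
A fibrewise opfibration `p : A ⟶ C` is factored through the quotient of its fibres by their
connected components.

*One fibre.* Let `p : A ⥤ C` be an opfibration of categories, and identify two objects of `A` if
they are joined by a zigzag of arrows over identities of `C`. Let `s : Q ⥤ C` be a discrete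
opfibration whose objects are the resulting classes, with quotient functor `q : A ⥤ Q`
(`Functor.IsComponentFactorization`). An arrow of `A` factors as an opcartesian arrow followed by
one over an identity, so anything that is invariant under composition with arrows over identities
depends only on the image of the arrow in `C` and on the class of its source
(`Functor.IsOpfibration.invariant_eq`). Every functor that maps the arrows over identities to
identities therefore descends along `q`, uniquely, and likewise for natural transformations; since
the identee of `p` consists of the arrows over identities, `q` is its coidentifier
(`Functor.IsComponentFactorization.isCoidentifier`), and it is an initial functor.

*The fibration of components.* The objects of `FibCat.components p hp` are the classes of objects of
`A`, taken over all of `C` at once. Its arrows are certain arrows of `C`: factor `γ` as a vertical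
arrow followed by a chosen lift, and require that the vertical part lift to an arrow of `A` from the
class of the source to the reindexing of the class of the target (`FibCat.Components.IsHom`).
Reindexing in `A` preserves arrows over identities of `C`, so it acts on classes, and it supplies a
cleavage that both the quotient morphism and the projection to `C` preserve strictly. On every fibre
this is the factorization of the preceding paragraph (`FibCat.isComponentFactorization`).

*From the fibres to `Fib(B)`.* Uniqueness makes the functors that are induced on the fibres commute
with reindexing. They extend to all arrows, again by splitting off the vertical part, and the
extension is functorial because every composite of chosen lifts comes from `A`
(`FibCat.VertFunctor.IsDesc.exists_hom`). So a morphism that is surjective on objects and a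
coidentifier on each fibre is a coidentifier (`FibCat.isCoidentifier_of_fiber`). In any 2-category a
coidentifier is initial, since 2-cells lifting identities along a discrete opfibration are
identities (`TwoCat.IsCoidentifier.isInitial`). Finally, a fibrewise discrete opfibration is a
discrete opfibration in `Fib(B)` (`FibCat.IsFibrewiseDiscreteOpfibration.isDiscreteOpfibration`).

Equalities between arrows whose ends are only propositionally equal are expressed in the category of
arrows, as `Arrow.mk f = Arrow.mk g`.
-/

/-! ### Arrows that are identities up to equality of objects -/

namespace CategoryTheory

section

universe v u v' u'

variable {X : Type u} [Category.{v} X] {Y : Type u'} [Category.{v'} Y]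

/-- The arrow `f` is an identity, up to a propositional equality between its ends. -/
def IsEqToHom {a b : X} (f : a ⟶ b) : Prop :=
  ∃ h : a = b, f = eqToHom h

lemma isEqToHom_eqToHom {a b : X} (h : a = b) : IsEqToHom (eqToHom h) := ⟨h, rfl⟩

lemma isEqToHom_id (a : X) : IsEqToHom (𝟙 a) := ⟨rfl, rfl⟩

lemma IsEqToHom.map {a b : X} {f : a ⟶ b} (hf : IsEqToHom f) (F : X ⥤ Y) :
    IsEqToHom (F.map f) := by
  obtain ⟨rfl, rfl⟩ := hf
  exact ⟨rfl, by simp⟩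

lemma IsEqToHom.arrow_comp_left {a b c : X} {e : a ⟶ b} (he : IsEqToHom e) (f : b ⟶ c) :
    Arrow.mk (e ≫ f) = Arrow.mk f := by
  obtain ⟨rfl, rfl⟩ := he
  simp

lemma IsEqToHom.arrow_comp_right {a b c : X} {e : b ⟶ c} (he : IsEqToHom e) (f : a ⟶ b) :
    Arrow.mk (f ≫ e) = Arrow.mk f := by
  obtain ⟨rfl, rfl⟩ := he
  simp

lemma arrow_left_eq {a b a' b' : X} {f : a ⟶ b} {f' : a' ⟶ b'}
    (h : Arrow.mk f = Arrow.mk f') : a = a' :=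
  congrArg (fun g : Arrow X => g.left) h

lemma arrow_right_eq {a b a' b' : X} {f : a ⟶ b} {f' : a' ⟶ b'}
    (h : Arrow.mk f = Arrow.mk f') : b = b' :=
  congrArg (fun g : Arrow X => g.right) h

lemma IsEqToHom.of_arrow_eq {a b a' b' : X} {f : a ⟶ b} {f' : a' ⟶ b'} (hf : IsEqToHom f)
    (h : Arrow.mk f = Arrow.mk f') : IsEqToHom f' := by
  obtain rfl := arrow_left_eq h
  obtain rfl := arrow_right_eq h
  obtain rfl := (Arrow.mk_inj _ _).1 h
  exact hf

lemma arrow_comp_congr {a b c a' b' c' : X} {f : a ⟶ b} {g : b ⟶ c} {f' : a' ⟶ b'}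
    {g' : b' ⟶ c'} (hf : Arrow.mk f = Arrow.mk f') (hg : Arrow.mk g = Arrow.mk g') :
    Arrow.mk (f ≫ g) = Arrow.mk (f' ≫ g') := by
  obtain rfl := arrow_left_eq hf
  obtain rfl := arrow_right_eq hf
  obtain rfl := arrow_right_eq hg
  obtain rfl := (Arrow.mk_inj _ _).1 hf
  obtain rfl := (Arrow.mk_inj _ _).1 hg
  rfl

lemma arrow_map_congr {a b a' b' : X} {f : a ⟶ b} {f' : a' ⟶ b'}
    (h : Arrow.mk f = Arrow.mk f') (F : X ⥤ Y) : Arrow.mk (F.map f) = Arrow.mk (F.map f') :=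
  congrArg F.mapArrow.obj h

lemma arrow_id_congr {a a' : X} (h : a = a') : Arrow.mk (𝟙 a) = Arrow.mk (𝟙 a') := by
  rw [h]

lemma exists_eqToHom_comp {a a' b : X} {f : a ⟶ b} {f' : a' ⟶ b}
    (h : Arrow.mk f = Arrow.mk f') : ∃ e : a = a', f = eqToHom e ≫ f' := by
  obtain rfl := arrow_left_eq h
  exact ⟨rfl, by simpa using (Arrow.mk_inj _ _).1 h⟩

lemma arrow_conj {a a' b b' : X} (e : a = a') (f : a' ⟶ b')
    (e' : b' = b) : Arrow.mk (eqToHom e ≫ f ≫ eqToHom e') = Arrow.mk f := by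
  simp

lemma isHomLift_iff_arrow (p : X ⥤ Y) {R S : Y} {a b : X} (f : R ⟶ S) (φ : a ⟶ b) :
    p.IsHomLift f φ ↔ Arrow.mk (p.map φ) = Arrow.mk f := by
  constructor
  · rintro ⟨⟩
    rfl
  · intro h
    obtain rfl := arrow_left_eq h
    obtain rfl := arrow_right_eq h
    obtain rfl := (Arrow.mk_inj _ _).1 h
    infer_instance

lemma isHomLift_of_arrow_eq (p : X ⥤ Y) {R S : Y}
    {β : R ⟶ S} {a b a' b' : X} {f : a ⟶ b} {f' : a' ⟶ b'} (e : Arrow.mk f = Arrow.mk f')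
    (h : p.IsHomLift β f) : p.IsHomLift β f' :=
  (isHomLift_iff_arrow _ _ _).2 ((arrow_map_congr e p).symm.trans ((isHomLift_iff_arrow _ _ _).1 h))

lemma IsEqToHom.isHomLift (p : X ⥤ Y)
    {a a' : X} {f : a ⟶ a'} (hf : IsEqToHom f) {R : Y} (h : p.obj a = R) :
    p.IsHomLift (𝟙 R) f := by
  obtain ⟨rfl, rfl⟩ := hf
  exact IsHomLift.id h

lemma functor_ext_of_arrow {F G : X ⥤ Y}
    (h : ∀ {a b : X} (f : a ⟶ b), Arrow.mk (F.map f) = Arrow.mk (G.map f)) : F = G :=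
  Arrow.functor_ext fun _ _ f => h f

/-- A natural transformation whose components are identities up to equality can only exist between
equal functors. -/
lemma functor_eq_of_isEqToHom_app {F G : X ⥤ Y} (α : F ⟶ G)
    (h : ∀ a, IsEqToHom (α.app a)) : F = G :=
  functor_ext_of_arrow fun {a b} f => by
    rw [← (h b).arrow_comp_right (F.map f), α.naturality, (h a).arrow_comp_left]

end

/-! ### The comprehensive factorization of an opfibration -/

namespace Functor

section

universe vA uA vC uC vQ uQ vZ uZ

variable {A : Type uA} [Category.{vA} A] {C : Type uC} [Category.{vC} C]
  {Q : Type uQ} [Category.{vQ} Q] {Z : Type uZ} [Category.{vZ} Z]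

/-- The relation on objects given by the arrows that `p` maps to identities. -/
def VertRel (p : A ⥤ C) (a a' : A) : Prop :=
  ∃ φ : a ⟶ a', IsEqToHom (p.map φ)

/-- Opcartesian lifts, with equalities of arrows in place of lifting over a given arrow: every other
lift factors through the opcartesian one by an arrow over an identity. -/
lemma IsOpfibration.exists_lift {p : A ⥤ C} (hp : p.IsOpfibration) {a : A} {c d : C}
    (v : c ⟶ d) (h : p.obj a = c) :
    ∃ (w : A) (φ : a ⟶ w), Arrow.mk (p.map φ) = Arrow.mk v ∧
      ∀ {w' : A} (φ' : a ⟶ w'), Arrow.mk (p.map φ') = Arrow.mk v →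
        ∃ θ : w ⟶ w', IsEqToHom (p.map θ) ∧ φ ≫ θ = φ' := by
  subst h
  obtain ⟨w, φ, hφ⟩ := hp a d v
  refine ⟨w, φ, (isHomLift_iff_arrow p v φ).1 inferInstance, fun φ' h' => ?_⟩
  have hl : p.IsHomLift v φ' := (isHomLift_iff_arrow p v φ').2 h'
  refine ⟨Functor.IsCocartesian.map p v φ φ', ?_, Functor.IsCocartesian.fac p v φ φ'⟩
  have := (isHomLift_iff_arrow p (𝟙 d) (Functor.IsCocartesian.map p v φ φ')).1 inferInstance
  exact (isEqToHom_id d).of_arrow_eq this.symm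

/-- An invariant of arrows of the total category of an opfibration that does not change when an
arrow is composed, on either side, with an arrow over an identity, depends only on the image of the
arrow in the base and on the component, in the fibre, of its source. -/
lemma IsOpfibration.invariant_eq {p : A ⥤ C} (hp : p.IsOpfibration) {T : Sort*}
    (F : ∀ {a w : A}, (a ⟶ w) → T)
    (hr : ∀ {a w w' : A} (φ : a ⟶ w) (θ : w ⟶ w'), IsEqToHom (p.map θ) → F (φ ≫ θ) = F φ)
    (hl : ∀ {a a' w : A} (θ : a ⟶ a') (φ : a' ⟶ w), IsEqToHom (p.map θ) → F (θ ≫ φ) = F φ)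
    {a a' : A} (h : Relation.EqvGen p.VertRel a a') {w w' : A} (φ : a ⟶ w) (φ' : a' ⟶ w')
    (hφ : Arrow.mk (p.map φ) = Arrow.mk (p.map φ')) : F φ = F φ' := by
  -- Two arrows out of the same object factor through a common opcartesian lift.
  have same : ∀ {a w w' : A} (φ : a ⟶ w) (φ' : a ⟶ w'),
      Arrow.mk (p.map φ) = Arrow.mk (p.map φ') → F φ = F φ' := by
    intro a w w' φ φ' h
    obtain ⟨u, ψ, -, hψ⟩ := hp.exists_lift (p.map φ) rfl
    obtain ⟨θ, hθ, rfl⟩ := hψ φ rfl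
    obtain ⟨θ', hθ', rfl⟩ := hψ φ' h.symm
    rw [hr _ _ hθ, hr _ _ hθ']
  induction h generalizing w w' with
  | rel a a' h =>
    obtain ⟨θ, hθ⟩ := h
    rw [← hl θ φ' hθ]
    refine same _ _ ?_
    rw [p.map_comp, hθ.arrow_comp_left, hφ]
  | refl a => exact same _ _ hφ
  | symm a a' _ ih => exact (ih φ' φ hφ.symm).symm
  | trans a a' a'' h₁ h₂ ih₁ ih₂ =>
    have e : p.obj a' = p.obj a := by
      clear ih₁ ih₂ hφ φ φ' h₂
      induction h₁ with
      | rel _ _ h => exact h.choose_spec.choose.symm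
      | refl _ => rfl
      | symm _ _ _ ih => exact ih.symm
      | trans _ _ _ _ _ ih ih' => exact ih'.trans ih
    obtain ⟨u, ψ, hψ, -⟩ := hp.exists_lift (p.map φ) e
    exact (ih₁ φ ψ hψ.symm).trans (ih₂ ψ φ' (hψ.trans hφ))

/-- The factorization `p = q ⋙ s` of an opfibration through the quotient of its fibres by their
connected components: `s` is a discrete opfibration, `q` is surjective on objects, and `q`
identifies exactly the objects in a common component of a fibre of `p`. -/
structure IsComponentFactorization (p : A ⥤ C) (q : A ⥤ Q) (s : Q ⥤ C) : Prop where
  fac : q ⋙ s = p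
  isOpfibration : p.IsOpfibration
  isDiscreteOpfibration : s.IsDiscreteOpfibration
  surjective : Function.Surjective q.obj
  eqvGen : ∀ {a a' : A}, q.obj a = q.obj a' → Relation.EqvGen p.VertRel a a'

lemma IsDiscreteOpfibration.eq_of_map_eq {s : Q ⥤ C} (hs : s.IsDiscreteOpfibration)
    {x x' y y' : Q} (m : x ⟶ y) (m' : x' ⟶ y') (hx : x = x')
    (h : Arrow.mk (s.map m) = Arrow.mk (s.map m')) : Arrow.mk m = Arrow.mk m' := by
  subst hx
  have := (hs x _ (s.map m)).unique (y₁ := ⟨y, m⟩) (y₂ := ⟨y', m'⟩)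
    ((isHomLift_iff_arrow _ _ _).2 rfl) ((isHomLift_iff_arrow _ _ _).2 h.symm)
  obtain ⟨rfl, h⟩ := Sigma.mk.inj this
  rw [eq_of_heq h]

lemma IsDiscreteOpfibration.isEqToHom_of_map {s : Q ⥤ C} (hs : s.IsDiscreteOpfibration)
    {x y : Q} {m : x ⟶ y} (h : IsEqToHom (s.map m)) : IsEqToHom m := by
  refine (isEqToHom_id x).of_arrow_eq (hs.eq_of_map_eq _ _ rfl ?_)
  rw [s.map_id, ← h.arrow_comp_right, Category.id_comp]

namespace IsComponentFactorization

variable {p : A ⥤ C} {q : A ⥤ Q} {s : Q ⥤ C} (H : IsComponentFactorization p q s)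
include H

lemma map_arrow {a w : A} (φ : a ⟶ w) : Arrow.mk (s.map (q.map φ)) = Arrow.mk (p.map φ) := by
  have := H.fac
  subst this
  rfl

lemma isEqToHom_map {a w : A} (φ : a ⟶ w) (h : IsEqToHom (p.map φ)) : IsEqToHom (q.map φ) :=
  H.isDiscreteOpfibration.isEqToHom_of_map (h.of_arrow_eq (H.map_arrow φ).symm)

/-- Every arrow of `Q` is the image of an arrow of `A` with prescribed source. -/
lemma exists_lift {y y' : Q} (v : y ⟶ y') {a : A} (ha : q.obj a = y) :
    ∃ (w : A) (φ : a ⟶ w), Arrow.mk (q.map φ) = Arrow.mk v := by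
  subst ha
  obtain ⟨w, φ, hφ, -⟩ := H.isOpfibration.exists_lift (s.map v) (a := a)
    (by rw [← H.fac]; rfl)
  exact ⟨w, φ, H.isDiscreteOpfibration.eq_of_map_eq _ _ rfl ((H.map_arrow φ).trans hφ)⟩

lemma exists_arrow_lift {y y' : Q} (v : y ⟶ y') :
    ∃ (a w : A) (φ : a ⟶ w), Arrow.mk (q.map φ) = Arrow.mk v :=
  have ⟨a, ha⟩ := H.surjective y
  ⟨a, H.exists_lift v ha⟩

section

variable {z : A ⥤ Z} (hz : ∀ {a a' : A} (φ : a ⟶ a'), IsEqToHom (p.map φ) → IsEqToHom (z.map φ))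
include hz

/-- If `z` maps to identities all the arrows that `p` maps to identities, then `z` takes equal
values on arrows that `q` identifies. -/
lemma arrow_eq {a a' w w' : A} (φ : a ⟶ w) (φ' : a' ⟶ w')
    (h : Arrow.mk (q.map φ) = Arrow.mk (q.map φ')) :
    Arrow.mk (z.map φ) = Arrow.mk (z.map φ') := by
  refine H.isOpfibration.invariant_eq (fun φ => Arrow.mk (z.map φ)) ?_ ?_
    (H.eqvGen (arrow_left_eq h)) φ φ' ?_
  · intro a w w' φ θ hθ
    rw [z.map_comp, (hz θ hθ).arrow_comp_right]
  · intro a w w' φ θ hθ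
    rw [z.map_comp, (hz _ hθ).arrow_comp_left]
  · rw [← H.map_arrow, ← H.map_arrow, arrow_map_congr h]

/-- A functor that maps to identities all the arrows that `p` maps to identities factors through
`q`: its value on an arrow of `Q` is its value on any lift of that arrow to `A`. -/
lemma exists_desc : ∃ t : Q ⥤ Z, q ⋙ t = z := by
  have hobj : ∀ {a a' : A}, q.obj a = q.obj a' → z.obj a = z.obj a' := fun {a a'} h =>
    arrow_left_eq (H.arrow_eq hz (𝟙 a) (𝟙 a') (by
      rw [q.map_id, q.map_id, h]))
  choose o ho using H.surjective
  choose src tgt lft hlft using fun {y y' : Q} (v : y ⟶ y') => H.exists_arrow_lift v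
  have e₁ : ∀ {y y' : Q} (v : y ⟶ y'), z.obj (o y) = z.obj (src v) := fun v =>
    hobj ((ho _).trans (arrow_left_eq (hlft v)).symm)
  have e₂ : ∀ {y y' : Q} (v : y ⟶ y'), z.obj (tgt v) = z.obj (o y') := fun v =>
    hobj ((arrow_right_eq (hlft v)).trans (ho _).symm)
  let m : ∀ {y y' : Q} (v : y ⟶ y'), z.obj (o y) ⟶ z.obj (o y') := fun v =>
    eqToHom (e₁ v) ≫ z.map (lft v) ≫ eqToHom (e₂ v)
  have hm : ∀ {y y' : Q} (v : y ⟶ y') {a w : A} (φ : a ⟶ w),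
      Arrow.mk (q.map φ) = Arrow.mk v → Arrow.mk (m v) = Arrow.mk (z.map φ) := by
    intro y y' v a w φ h
    simp only [m, Arrow.arrow_mk_eqToHom_comp, Arrow.arrow_mk_comp_eqToHom]
    exact H.arrow_eq hz _ _ ((hlft v).trans h.symm)
  refine ⟨{ obj := fun y => z.obj (o y)
            map := fun v => m v
            map_id := fun y => ?_
            map_comp := fun {y y' y''} v v' => ?_ }, ?_⟩
  · rw [← Arrow.mk_inj, hm (𝟙 y) (𝟙 (o y)) (by rw [q.map_id, ho]), z.map_id]
  · obtain ⟨a, w, φ, hφ⟩ := H.exists_arrow_lift v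
    obtain ⟨w', φ', hφ'⟩ := H.exists_lift v' (arrow_right_eq hφ)
    rw [← Arrow.mk_inj, hm (v ≫ v') (φ ≫ φ') (by
      rw [q.map_comp]; exact arrow_comp_congr hφ hφ'), z.map_comp]
    exact arrow_comp_congr (hm _ _ hφ).symm (hm _ _ hφ').symm
  · exact functor_ext_of_arrow fun φ => hm _ φ rfl

end

lemma existsUnique_desc₂ {t t' : Q ⥤ Z} (β : q ⋙ t ⟶ q ⋙ t') :
    ∃! γ : t ⟶ t', whiskerLeft q γ = β := by
  have hβ : ∀ {a a' : A}, q.obj a = q.obj a' → Arrow.mk (β.app a) = Arrow.mk (β.app a') := by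
    intro a a' h
    have := H.eqvGen h
    clear h
    induction this with
    | rel a a' h =>
      obtain ⟨θ, hθ⟩ := h
      have h₁ := (H.isEqToHom_map θ hθ)
      rw [← (h₁.map t).arrow_comp_left (β.app a'), ← (h₁.map t').arrow_comp_right (β.app a)]
      exact (Arrow.mk_inj _ _).2 (β.naturality θ).symm
    | refl a => rfl
    | symm _ _ _ ih => exact ih.symm
    | trans _ _ _ _ _ ih ih' => exact ih.trans ih'
  choose o ho using H.surjective
  let g : ∀ y, t.obj y ⟶ t'.obj y := fun y =>
    eqToHom (congrArg t.obj (ho y).symm) ≫ β.app (o y) ≫ eqToHom (congrArg t'.obj (ho y))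
  have hg : ∀ y a, q.obj a = y → Arrow.mk (g y) = Arrow.mk (β.app a) := by
    intro y a h
    simp only [g, Arrow.arrow_mk_eqToHom_comp, Arrow.arrow_mk_comp_eqToHom]
    exact hβ ((ho y).trans h.symm)
  refine ⟨{ app := g, naturality := fun y y' v => ?_ }, ?_, ?_⟩
  · obtain ⟨a, w, φ, hφ⟩ := H.exists_arrow_lift v
    rw [← Arrow.mk_inj, arrow_comp_congr (arrow_map_congr hφ t).symm
      (hg y' w (arrow_right_eq hφ)), arrow_comp_congr (hg y a (arrow_left_eq hφ))
      (arrow_map_congr hφ t').symm]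
    exact (Arrow.mk_inj _ _).2 (β.naturality φ)
  · ext a
    exact (Arrow.mk_inj _ _).1 (hg _ a rfl)
  · intro γ hγ
    ext y
    obtain ⟨a, rfl⟩ := H.surjective y
    refine (Arrow.mk_inj _ _).1 ((hg _ a rfl).trans ?_).symm
    rw [← hγ]
    rfl

/-- The quotient functor is initial: an object `q a ⟶ y` of the comma category can be moved along a
lift of its arrow to one whose arrow is an identity, and those are connected with each other inside
a fibre of `p`. -/
lemma initial : q.Initial where
  out y := by
    obtain ⟨a₀, ha₀⟩ := H.surjective y
    have : Nonempty (CostructuredArrow q y) := ⟨CostructuredArrow.mk (Y := a₀) (eqToHom ha₀)⟩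
    have key : ∀ {a a' : A} (_ : Relation.EqvGen p.VertRel a a') (h : q.obj a = y)
        (h' : q.obj a' = y), Zigzag (CostructuredArrow.mk (eqToHom h))
          (CostructuredArrow.mk (eqToHom h')) := by
      intro a a' h
      have hq : ∀ {a a' : A}, Relation.EqvGen p.VertRel a a' → q.obj a = q.obj a' := by
        intro a a' h
        induction h with
        | rel _ _ h => exact (H.isEqToHom_map _ h.choose_spec).choose
        | refl _ => rfl
        | symm _ _ _ ih => exact ih.symm
        | trans _ _ _ _ _ ih ih' => exact ih.trans ih'
      induction h with
      | rel a a' h =>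
        intro h₁ h₂
        obtain ⟨θ, hθ⟩ := h
        obtain ⟨e, he⟩ := H.isEqToHom_map θ hθ
        exact Zigzag.of_hom (CostructuredArrow.homMk θ (by simp [he]))
      | refl a => exact fun _ _ => Zigzag.refl _
      | symm a a' _ ih => exact fun h₁ h₂ => (ih h₂ h₁).symm
      | trans a a' a'' h h' ih ih' =>
        exact fun h₁ h₂ => (ih h₁ ((hq h).symm.trans h₁)).trans (ih' _ h₂)
    have toBase : ∀ j : CostructuredArrow q y,
        Zigzag j (CostructuredArrow.mk (Y := a₀) (eqToHom ha₀)) := by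
      intro j
      obtain ⟨w, φ, hφ⟩ := H.exists_lift j.hom rfl
      have hw : q.obj w = y := arrow_right_eq hφ
      have hom : j ⟶ CostructuredArrow.mk (Y := w) (eqToHom hw) :=
        CostructuredArrow.homMk φ (by
          rw [← Arrow.mk_inj]
          simpa using hφ)
      exact (Zigzag.of_hom hom).trans (key (H.eqvGen (hw.trans ha₀.symm)) _ _)
    exact zigzag_isConnected fun j₁ j₂ => (toBase j₁).trans (toBase j₂).symm

end IsComponentFactorization

end

end Functor

end CategoryTheory

/-! ### Coidentifiers and initial 1-cells -/

namespace TwoCat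

section

universe w v u

variable {C : Type u} [Bicategory.{w, v} C] [Bicategory.Strict C]

open Bicategory

lemma isIdentity_whiskerRight_comp {X Y Z W : C} {f g : X ⟶ Y} (α : f ⟶ g) (h : Y ⟶ Z)
    (k : Z ⟶ W) : IsIdentity (α ▷ (h ≫ k)) ↔ IsIdentity (α ▷ h ▷ k) := by
  have e₁ : IsEqToHom (α_ f h k).hom :=
    ⟨Bicategory.Strict.assoc f h k, by rw [Bicategory.Strict.associator_eqToIso]; rfl⟩
  have e₂ : IsEqToHom (α_ g h k).inv :=
    ⟨(Bicategory.Strict.assoc g h k).symm, by rw [Bicategory.Strict.associator_eqToIso]; rfl⟩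
  have e₃ : IsEqToHom (α_ g h k).hom :=
    ⟨Bicategory.Strict.assoc g h k, by rw [Bicategory.Strict.associator_eqToIso]; rfl⟩
  have : (α_ f h k).hom ≫ α ▷ (h ≫ k) = α ▷ h ▷ k ≫ (α_ g h k).hom := by simp
  have e : Arrow.mk (α ▷ (h ≫ k)) = Arrow.mk (α ▷ h ▷ k) := by
    rw [← e₁.arrow_comp_left (α ▷ (h ≫ k)), this, e₃.arrow_comp_right]
  exact ⟨fun H => IsEqToHom.of_arrow_eq H e, fun H => IsEqToHom.of_arrow_eq H e.symm⟩

lemma IsIdentity.whiskerRight {X Y Z : C} {f g : X ⟶ Y} {α : f ⟶ g} (h : IsIdentity α)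
    (k : Y ⟶ Z) : IsIdentity (α ▷ k) := by
  obtain ⟨rfl, rfl⟩ := h
  exact ⟨rfl, by simp⟩

/-- Every coidentifier is initial: if `κ` becomes an identity after composition with `a ≫ d`, where
`d` is a discrete opfibration, then it already becomes one after composition with `a`, because a
lift of an identity along `d` is an identity. -/
lemma IsCoidentifier.isInitial {X A Q : C} {f g : X ⟶ A} {κ : f ⟶ g} {q : A ⟶ Q}
    (H : IsCoidentifier κ q) : IsInitial q where
  existsUnique_hom {E D} d hd a b hab := by
    have h₁ : IsIdentity (κ ▷ (q ≫ b)) :=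
      (isIdentity_whiskerRight_comp κ q b).2 (H.isIdentity.whiskerRight b)
    have h₂ : IsIdentity (κ ▷ a ▷ d) :=
      (isIdentity_whiskerRight_comp κ a d).1 (by rw [hab]; exact h₁)
    have h₃ : IsIdentity (κ ▷ a) := (hd X).isEqToHom_of_map h₂
    obtain ⟨t, ht, htu⟩ := H.existsUnique_hom a h₃
    refine ⟨t, ⟨ht, ?_⟩, fun t' ht' => htu t' ht'.1⟩
    refine (H.existsUnique_hom (q ≫ b) h₁).unique ?_ rfl
    rw [← Bicategory.Strict.assoc, ht, hab]
  existsUnique_hom₂ {E D} d hd t t' α β h := by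
    obtain ⟨γ, hγ, hγu⟩ := H.existsUnique_hom₂ α
    refine ⟨γ, ⟨hγ, ?_⟩, fun γ' h' => hγu γ' h'.1⟩
    have : ∀ δ : t ≫ d ⟶ t' ≫ d, q ◁ δ = (α_ q t d).inv ≫ α ▷ d ≫ (α_ q t' d).hom → δ = β := by
      intro δ hδ
      refine (H.existsUnique_hom₂ _).unique hδ ?_
      rw [h]
      simp
    refine this _ ?_
    rw [← hγ]
    simp

end

end TwoCat

namespace CategoryTheory.Cat

universe v u

lemma isIdentity_iff {X Y : Cat.{v, u}} {F G : X ⟶ Y} (α : F ⟶ G) :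
    TwoCat.IsIdentity α ↔ ∀ x : X, IsEqToHom (α.toNatTrans.app x) := by
  constructor
  · rintro ⟨rfl, rfl⟩ x
    exact isEqToHom_id _
  · intro h
    obtain rfl : F = G := Cat.Hom.ext (functor_eq_of_isEqToHom_app α.toNatTrans h)
    refine ⟨rfl, ?_⟩
    ext x
    exact (h x).choose_spec

end CategoryTheory.Cat

namespace CategoryTheory.Functor

universe v u

/-- The projection onto the quotient of the fibres by their components is a coidentifier in the
`2`-category of categories of any 2-cell whose components are, up to equality, the arrows over
identities. -/
lemma IsComponentFactorization.isCoidentifier {A Q C K : Type u} [Category.{v} A] [Category.{v} C]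
    [Category.{v} Q] [Category.{v} K] {p : A ⥤ C} {q : A ⥤ Q} {s : Q ⥤ C}
    (H : IsComponentFactorization p q s) {k₀ k₁ : K ⥤ A} (κ : k₀ ⟶ k₁)
    (hκ : ∀ x, IsEqToHom (p.map (κ.app x)))
    (hκ' : ∀ {a a' : A} (φ : a ⟶ a'), IsEqToHom (p.map φ) →
      ∃ x, Arrow.mk (κ.app x) = Arrow.mk φ) :
    TwoCat.IsCoidentifier κ.toCatHom₂ q.toCatHom where
  isIdentity := (Cat.isIdentity_iff _).2 fun x => H.isEqToHom_map _ (hκ x)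
  existsUnique_hom {Z} z h := by
    have hz : ∀ {a a' : A} (φ : a ⟶ a'), IsEqToHom (p.map φ) →
        IsEqToHom (z.toFunctor.map φ) := by
      intro a a' φ hφ
      obtain ⟨x, hx⟩ := hκ' φ hφ
      exact IsEqToHom.of_arrow_eq ((Cat.isIdentity_iff _).1 h x) (arrow_map_congr hx z.toFunctor)
    obtain ⟨t, ht⟩ := H.exists_desc hz
    refine ⟨t.toCatHom, Cat.Hom.ext ht, fun t' ht' => Cat.Hom.ext ?_⟩
    have e : q ⋙ t'.toFunctor = q ⋙ t := (congrArg Cat.Hom.toFunctor ht').trans ht.symm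
    obtain ⟨γ, hγ, -⟩ := H.existsUnique_desc₂ (eqToHom e)
    refine functor_eq_of_isEqToHom_app γ fun y => ?_
    obtain ⟨a, rfl⟩ := H.surjective y
    have : γ.app (q.obj a) = (eqToHom e).app a := congrArg (fun δ => δ.app a) hγ
    rw [this, eqToHom_app]
    exact isEqToHom_eqToHom _
  existsUnique_hom₂ {Z t t'} β := by
    obtain ⟨γ, hγ, hγu⟩ := H.existsUnique_desc₂ (t := t.toFunctor) (t' := t'.toFunctor)
      β.toNatTrans
    refine ⟨γ.toCatHom₂, Cat.Hom₂.ext hγ, fun γ' h' => Cat.Hom₂.ext ?_⟩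
    exact hγu γ'.toNatTrans (congrArg (fun δ => δ.toNatTrans) h')

end CategoryTheory.Functor

/-! ### Cloven fibrations -/

namespace FibCat

variable {B : Type u₁} [Category.{v₁} B]

section

variable {A C D : FibCat.{v₁, u₁, v₂, u₂} B}

lemma pull_congr (A : FibCat.{v₁, u₁, v₂, u₂} B) {R S : B} (β : R ⟶ S) {a a' : A.obj}
    (e : a = a') (h : A.p.obj a = S) (h' : A.p.obj a' = S) : A.pull β h = A.pull β h' := by
  subst e
  rfl

lemma arrow_lift_congr (A : FibCat.{v₁, u₁, v₂, u₂} B) {R S : B} (β : R ⟶ S) {a a' : A.obj}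
    (e : a = a') (h : A.p.obj a = S) (h' : A.p.obj a' = S) :
    Arrow.mk (A.lift β h) = Arrow.mk (A.lift β h') := by
  subst e
  rfl

lemma pull_over (A : FibCat.{v₁, u₁, v₂, u₂} B) {R S : B} (β : R ⟶ S) {a : A.obj}
    (h : A.p.obj a = S) : A.p.obj (A.pull β h) = R :=
  IsHomLift.domain_eq A.p β (A.lift β h)

/-- The vertical part of an arrow `m` over `β`: the arrow over an identity whose composite with the
chosen lift of `β` is `m`. -/
noncomputable def vert (A : FibCat.{v₁, u₁, v₂, u₂} B) {R S : B} (β : R ⟶ S) {a b : A.obj}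
    (h : A.p.obj b = S) (m : a ⟶ b) [A.p.IsHomLift β m] : a ⟶ A.pull β h :=
  Functor.IsCartesian.map A.p β (A.lift β h) m

instance vert_isHomLift (A : FibCat.{v₁, u₁, v₂, u₂} B) {R S : B} (β : R ⟶ S) {a b : A.obj}
    (h : A.p.obj b = S) (m : a ⟶ b) [A.p.IsHomLift β m] :
    A.p.IsHomLift (𝟙 R) (A.vert β h m) :=
  Functor.IsCartesian.map_isHomLift A.p β (A.lift β h) m

section

variable {R S : B} (β : R ⟶ S) {a b : A.obj} (h : A.p.obj b = S) (m : a ⟶ b)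
  [A.p.IsHomLift β m]

lemma vert_lift : A.vert β h m ≫ A.lift β h = m :=
  Functor.IsCartesian.fac A.p β (A.lift β h) m

lemma vert_lift_assoc {c : A.obj} (k : b ⟶ c) : A.vert β h m ≫ A.lift β h ≫ k = m ≫ k := by
  rw [← Category.assoc, vert_lift]

lemma vert_uniq (v : a ⟶ A.pull β h) [A.p.IsHomLift (𝟙 R) v] (hv : v ≫ A.lift β h = m) :
    v = A.vert β h m :=
  Functor.IsCartesian.map_uniq A.p β (A.lift β h) m v hv

end

lemma vert_ext (A : FibCat.{v₁, u₁, v₂, u₂} B) {R S : B} (β : R ⟶ S) {a b : A.obj}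
    (h : A.p.obj b = S) {v v' : a ⟶ A.pull β h} (hv : A.p.IsHomLift (𝟙 R) v)
    (hv' : A.p.IsHomLift (𝟙 R) v') (e : v ≫ A.lift β h = v' ≫ A.lift β h) : v = v' :=
  Functor.IsCartesian.ext A.p β (A.lift β h) v v' e

/-- The vertical part of a composite: the vertical part of the first factor, followed by the
reindexing of the vertical part of the second, followed by the comparison of the chosen lifts. -/
lemma vert_comp (C : FibCat.{v₁, u₁, v₂, u₂} B) {R S S' : B} (β : R ⟶ S) (β' : S ⟶ S')
    {c d e : C.obj} (hd : C.p.obj d = S) (he : C.p.obj e = S') (γ : c ⟶ d) (δ : d ⟶ e)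
    [C.p.IsHomLift β γ] [C.p.IsHomLift β' δ] :
    C.vert (β ≫ β') he (γ ≫ δ) = C.vert β hd γ ≫
      C.vert β (C.pull_over β' he) (C.lift β hd ≫ C.vert β' he δ) ≫
        C.vert (β ≫ β') he (C.lift β (C.pull_over β' he) ≫ C.lift β' he) := by
  refine (C.vert_uniq (β ≫ β') he (γ ≫ δ) _ ?_).symm
  simp only [Category.assoc, vert_lift, vert_lift_assoc]

lemma arrow_vert_congr (A : FibCat.{v₁, u₁, v₂, u₂} B) {R S : B} (β : R ⟶ S)
    {a b a' b' : A.obj} (h : A.p.obj b = S) (h' : A.p.obj b' = S) (m : a ⟶ b) (m' : a' ⟶ b')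
    [A.p.IsHomLift β m] [A.p.IsHomLift β m'] (e : Arrow.mk m = Arrow.mk m') :
    Arrow.mk (A.vert β h m) = Arrow.mk (A.vert β h' m') := by
  obtain rfl := arrow_left_eq e
  obtain rfl := arrow_right_eq e
  obtain rfl := (Arrow.mk_inj _ _).1 e
  rfl

namespace Hom

lemma ext_functor {F G : Hom A C} (h : F.toFunctor = G.toFunctor) : F = G := by
  obtain ⟨⟨F, _⟩, _⟩ := F
  obtain ⟨⟨G, _⟩, _⟩ := G
  obtain rfl : F = G := h
  rfl

lemma obj_over (F : Hom A C) {a : A.obj} {R : B} (h : A.p.obj a = R) : C.p.obj (F.obj a) = R :=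
  (F.w_obj a).trans h

lemma obj_pull (F : Hom A C) {R S : B} (β : R ⟶ S) {a : A.obj} (h : A.p.obj a = S) :
    F.obj (A.pull β h) = C.pull β (F.obj_over h) :=
  (F.map_lift β h).choose

lemma arrow_map_lift (F : Hom A C) {R S : B} (β : R ⟶ S) {a : A.obj} (h : A.p.obj a = S) :
    Arrow.mk (F.map (A.lift β h)) = Arrow.mk (C.lift β (F.obj_over h)) := by
  rw [(F.map_lift β h).choose_spec, Arrow.arrow_mk_eqToHom_comp]

lemma arrow_map_vert (F : Hom A C) {R S : B} (β : R ⟶ S) {a b : A.obj} (h : A.p.obj b = S)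
    (m : a ⟶ b) [A.p.IsHomLift β m] :
    Arrow.mk (F.map (A.vert β h m)) = Arrow.mk (C.vert β (F.obj_over h) (F.map m)) := by
  rw [← C.vert_uniq β (F.obj_over h) (F.map m) (F.map (A.vert β h m) ≫ eqToHom (F.obj_pull β h)) ?_,
    Arrow.arrow_mk_comp_eqToHom]
  rw [Category.assoc, ← Arrow.mk_inj]
  refine (arrow_comp_congr rfl ((Arrow.arrow_mk_eqToHom_comp _ _).trans
    (F.arrow_map_lift β h).symm)).trans ?_
  rw [← F.map_comp, vert_lift]

end Hom

/-- The component of a 2-cell at an object. -/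
abbrev app {F G : Hom A C} (α : F ⟶ G) (a : A.obj) : F.obj a ⟶ G.obj a :=
  α.toNatTrans.app a

lemma hom₂_ext {F G : Hom A C} {α β : F ⟶ G} (h : ∀ a, app α a = app β a) : α = β :=
  BasedNatTrans.homCategory.ext α β (NatTrans.ext (funext h))

lemma app_naturality {F G : Hom A C} (α : F ⟶ G) {a b : A.obj} (f : a ⟶ b) :
    F.map f ≫ app α b = app α a ≫ G.map f :=
  α.toNatTrans.naturality f

lemma app_isHomLift {F G : Hom A C} (α : F ⟶ G) {a : A.obj} {R : B} (h : A.p.obj a = R) :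
    C.p.IsHomLift (𝟙 R) (app α a) :=
  α.isHomLift h

lemma isIdentity_iff {F G : A ⟶ C} (α : F ⟶ G) :
    TwoCat.IsIdentity α ↔ ∀ a, IsEqToHom (app α a) := by
  constructor
  · rintro ⟨rfl, rfl⟩ a
    exact isEqToHom_id _
  · intro h
    obtain rfl : F = G := Hom.ext_functor (functor_eq_of_isEqToHom_app α.toNatTrans h)
    exact ⟨rfl, hom₂_ext fun a => (h a).choose_spec⟩

/-- An arrow over an identity, as an arrow of the fibre. -/
def fiberHomMk {R : B} {x y : A.obj} (v : x ⟶ y) (h : A.p.IsHomLift (𝟙 R) v) :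
    (Functor.Fiber.mk (IsHomLift.domain_eq A.p (𝟙 R) v)) ⟶
      (Functor.Fiber.mk (IsHomLift.codomain_eq A.p (𝟙 R) v)) :=
  ⟨v, h⟩

lemma isEqToHom_fiber_iff {b : B} {x y : A.p.Fiber b} (φ : x ⟶ y) :
    IsEqToHom φ ↔ IsEqToHom φ.1 := by
  constructor
  · intro h
    exact h.map Functor.Fiber.fiberInclusion
  · rintro ⟨h, h'⟩
    obtain rfl := Subtype.ext h
    exact ⟨rfl, Subtype.ext h'⟩

lemma arrow_fiber_iff {b : B} {x y x' y' : A.p.Fiber b} (φ : x ⟶ y) (φ' : x' ⟶ y') :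
    Arrow.mk φ = Arrow.mk φ' ↔ Arrow.mk φ.1 = Arrow.mk φ'.1 := by
  constructor
  · intro h
    exact arrow_map_congr h Functor.Fiber.fiberInclusion
  · intro h
    obtain rfl : x = x' := Subtype.ext (arrow_left_eq h)
    obtain rfl : y = y' := Subtype.ext (arrow_right_eq h)
    rw [Arrow.mk_inj]
    exact Subtype.ext ((Arrow.mk_inj _ _).1 h)

lemma reindex_map_lift {R S : B} (β : R ⟶ S) {x y : A.p.Fiber S} (v : x ⟶ y) :
    ((A.reindex β).map v).1 ≫ A.lift β y.2 = A.lift β x.2 ≫ v.1 := by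
  have := v.2
  exact Functor.IsCartesian.fac A.p β (A.lift β y.2) (A.lift β x.2 ≫ v.1)

/-- Morphisms of cloven fibrations commute with reindexing, on the nose. -/
lemma fiberFunctor_comp_reindex (F : Hom A C) {b' b : B} (β : b' ⟶ b) :
    fiberFunctor F b ⋙ C.reindex β = A.reindex β ⋙ fiberFunctor F b' := by
  refine functor_ext_of_arrow fun {x y} φ => ?_
  rw [arrow_fiber_iff]
  have := φ.2
  refine Eq.trans ?_ (F.arrow_map_vert β y.2 (A.lift β x.2 ≫ φ.1)).symm
  have : C.p.IsHomLift (𝟙 b) ((fiberFunctor F b).map φ).1 := ((fiberFunctor F b).map φ).2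
  refine C.arrow_vert_congr β _ _ (C.lift β ((fiberFunctor F b).obj x).2 ≫ _) _ ?_
  rw [F.map_comp]
  exact arrow_comp_congr (F.arrow_map_lift β x.2).symm rfl

end

end FibCat

/-! ### Constructing morphisms of cloven fibrations -/

namespace FibCat

variable {B : Type u₁} [Category.{v₁} B]

section

variable {A C : FibCat.{v₁, u₁, v₂, u₂} B}

lemma Hom.map_isHomLift (F : Hom A C) {R S : B} {β : R ⟶ S} {a b : A.obj} {m : a ⟶ b}
    (h : A.p.IsHomLift β m) : C.p.IsHomLift β (F.map m) :=
  BasedFunctor.preserves_isHomLift _ _ _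

/-- A functor over `B` that preserves the chosen lifts, as a morphism of cloven fibrations. -/
def Hom.ofFunctor (F : A.obj ⥤ C.obj) (w : F ⋙ C.p = A.p)
    (hF : ∀ {R S : B} (β : R ⟶ S) {a : A.obj} (h : A.p.obj a = S)
      (h' : C.p.obj (F.obj a) = S), Arrow.mk (F.map (A.lift β h)) = Arrow.mk (C.lift β h')) :
    Hom A C where
  toFunctor := F
  w := w
  map_lift β a h := exists_eqToHom_comp
    (hF β h ((congrArg (fun G => G.obj a) w).trans h))

end

/-! ### Fibrewise discrete opfibrations -/

section

variable {E D : FibCat.{v₁, u₁, v₂, u₂} B} {s : Hom E D}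

lemma IsFibrewiseDiscreteOpfibration.eq_of_map_eq (hs : IsFibrewiseDiscreteOpfibration s) {b : B}
    {x y x' y' : E.obj} {v : x ⟶ y} {v' : x' ⟶ y'} (hv : E.p.IsHomLift (𝟙 b) v)
    (hv' : E.p.IsHomLift (𝟙 b) v') (hx : x = x')
    (h : Arrow.mk (s.map v) = Arrow.mk (s.map v')) : Arrow.mk v = Arrow.mk v' := by
  let φ := fiberHomMk v hv
  let φ' := fiberHomMk v' hv'
  exact (arrow_fiber_iff φ φ').1 ((hs b).eq_of_map_eq φ φ' (Subtype.ext hx)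
    ((arrow_fiber_iff ((fiberFunctor s b).map φ) ((fiberFunctor s b).map φ')).2 h))

lemma IsFibrewiseDiscreteOpfibration.exists_lift (hs : IsFibrewiseDiscreteOpfibration s) {b : B}
    {x : E.obj} {c d : D.obj} (v : c ⟶ d) (hv : D.p.IsHomLift (𝟙 b) v) (hx : s.obj x = c) :
    ∃ (y : E.obj) (w : x ⟶ y), E.p.IsHomLift (𝟙 b) w ∧ Arrow.mk (s.map w) = Arrow.mk v := by
  subst hx
  have hx : E.p.obj x = b := (s.w_obj x).symm.trans (IsHomLift.domain_eq D.p (𝟙 b) v)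
  let φ : (fiberFunctor s b).obj ⟨x, hx⟩ ⟶ ⟨d, IsHomLift.codomain_eq D.p (𝟙 b) v⟩ := ⟨v, hv⟩
  obtain ⟨⟨y, w⟩, hw, -⟩ := hs b ⟨x, hx⟩ _ φ
  refine ⟨y.1, w.1, w.2, ?_⟩
  exact (arrow_fiber_iff _ _).1 ((isHomLift_iff_arrow _ _ _).1 hw)

/-- A fibrewise discrete opfibration is faithful, also on arrows that are not vertical: such arrows
are compared through their vertical parts. -/
lemma IsFibrewiseDiscreteOpfibration.eq_of_map_eq_of_ends (hs : IsFibrewiseDiscreteOpfibration s)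
    {x y x' y' : E.obj} {m : x ⟶ y} {m' : x' ⟶ y'} (hx : x = x') (hy : y = y')
    (h : Arrow.mk (s.map m) = Arrow.mk (s.map m')) : Arrow.mk m = Arrow.mk m' := by
  subst hx hy
  have hl : E.p.IsHomLift (E.p.map m) m' := by
    have : D.p.IsHomLift (E.p.map m) (s.map m') := by
      rw [← (Arrow.mk_inj _ _).1 h]
      infer_instance
    exact BasedFunctor.isHomLift_map s.toBasedFunctor _ _
  have hv : Arrow.mk (E.vert (E.p.map m) rfl m) = Arrow.mk (E.vert (E.p.map m) rfl m') := by
    refine hs.eq_of_map_eq (b := E.p.obj x) inferInstance inferInstance rfl ?_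
    rw [s.arrow_map_vert, s.arrow_map_vert]
    exact D.arrow_vert_congr _ _ _ _ _ h
  rw [← vert_lift (E.p.map m) rfl m, ← vert_lift (E.p.map m) rfl m', (Arrow.mk_inj _ _).1 hv]

variable {X : FibCat.{v₁, u₁, v₂, u₂} B}

/-- Every 2-cell `F ≫ s ⟶ G` lifts along a fibrewise discrete opfibration `s` to a 2-cell with
source `F`. The lifts `l x : F x ⟶ o x` of its components determine the new 1-cell on objects; on an
arrow `m`, the 1-cell is a lift of the vertical part of `G m`, followed by a chosen lift. -/
lemma IsFibrewiseDiscreteOpfibration.exists_lift_hom₂ (hs : IsFibrewiseDiscreteOpfibration s)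
    (F : Hom X E) (G : Hom X D) (α : Hom.comp F s ⟶ G) :
    ∃ (F' : Hom X E) (α' : F ⟶ F'), Hom.comp F' s = G ∧
      ∀ x, Arrow.mk (s.map (app α' x)) = Arrow.mk (app α x) := by
  choose o l hl hsl using fun x : X.obj =>
    hs.exists_lift (x := F.obj x) (app α x) (app_isHomLift α rfl) rfl
  have ho : ∀ x, s.obj (o x) = G.obj x := fun x => arrow_right_eq (hsl x)
  have hoo : ∀ x {S : B} (_ : X.p.obj x = S), E.p.obj (o x) = S := by
    rintro x S rfl
    rw [← s.w_obj, ho]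
    exact G.w_obj x
  -- The vertical part of `F.map m ≫ l x'` lies over the composite of `α` at `x` with the vertical
  -- part of `G.map m`.
  have hu : ∀ {R S : B} (β : R ⟶ S) {x x' : X.obj} (m : x ⟶ x') (h : X.p.obj x' = S)
      (_ : X.p.IsHomLift β m) (_ : E.p.IsHomLift β (F.map m ≫ l x'))
      (_ : D.p.IsHomLift β (G.map m)),
      Arrow.mk (s.map (E.vert β (hoo x' h) (F.map m ≫ l x'))) =
        Arrow.mk (app α x ≫ D.vert β (G.obj_over h) (G.map m)) := by
    intro R S β x x' m h hm h₁ h₂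
    have hα : D.p.IsHomLift (𝟙 R) (app α x) :=
      app_isHomLift α (IsHomLift.domain_eq X.p β m)
    have hαG : D.p.IsHomLift β (app α x ≫ G.map m) := inferInstance
    rw [s.arrow_map_vert, D.vert_uniq β (G.obj_over h) (app α x ≫ G.map m)
      (app α x ≫ D.vert β (G.obj_over h) (G.map m)) (by rw [Category.assoc, vert_lift])]
    refine D.arrow_vert_congr _ _ _ _ _ ?_
    rw [s.map_comp, ← app_naturality α m]
    exact arrow_comp_congr rfl (hsl x')
  have hlift : ∀ {R S : B} (β : R ⟶ S) {x x' : X.obj} (m : x ⟶ x') (h : X.p.obj x' = S)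
      (_ : X.p.IsHomLift β m), E.p.IsHomLift β (F.map m ≫ l x') := by
    intro R S β x x' m h hm
    have h₁ : E.p.IsHomLift β (F.map m) := F.map_isHomLift hm
    have h₂ : E.p.IsHomLift (𝟙 S) (l x') := h ▸ hl x'
    infer_instance
  have hex : ∀ {x x' : X.obj} (m : x ⟶ x'),
      ∃ n : o x ⟶ o x', Arrow.mk (s.map n) = Arrow.mk (G.map m) := by
    intro x x' m
    have hGm : D.p.IsHomLift (X.p.map m) (G.map m) := G.map_isHomLift inferInstance
    have hFm := hlift (X.p.map m) m rfl inferInstance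
    obtain ⟨w, k, hk, hk'⟩ := hs.exists_lift (x := o x) (b := X.p.obj x)
      (D.vert (X.p.map m) (G.obj_over rfl) (G.map m)) inferInstance (ho x)
    have hlk : E.p.IsHomLift (𝟙 (X.p.obj x)) (l x ≫ k) := by
      have := hl x
      infer_instance
    have e : Arrow.mk (l x ≫ k) =
        Arrow.mk (E.vert (X.p.map m) (hoo x' rfl) (F.map m ≫ l x')) := by
      refine hs.eq_of_map_eq hlk inferInstance rfl ?_
      rw [hu _ m rfl inferInstance hFm hGm, s.map_comp]
      exact arrow_comp_congr (hsl x) hk'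
    refine ⟨k ≫ eqToHom (arrow_right_eq e) ≫ E.lift (X.p.map m) (hoo x' rfl), ?_⟩
    rw [s.map_comp, ← vert_lift (X.p.map m) (G.obj_over rfl) (G.map m)]
    refine arrow_comp_congr hk' ?_
    rw [s.map_comp, ((isEqToHom_eqToHom _).map s.toFunctor).arrow_comp_left, s.arrow_map_lift]
    exact D.arrow_lift_congr _ (ho x') _ _
  choose n hn using fun {x x' : X.obj} (m : x ⟶ x') => hex m
  let F₀ : X.obj ⥤ E.obj :=
    { obj := o
      map := fun m => n m
      map_id := fun x => (Arrow.mk_inj _ _).1 (hs.eq_of_map_eq_of_ends rfl rfl (by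
        rw [hn, G.map_id, s.map_id, ho]))
      map_comp := fun m m' => (Arrow.mk_inj _ _).1 (hs.eq_of_map_eq_of_ends rfl rfl (by
        rw [hn, G.map_comp, s.map_comp]
        exact arrow_comp_congr (hn m).symm (hn m').symm)) }
  have hF₀ : F₀ ⋙ s.toFunctor = G.toFunctor := functor_ext_of_arrow fun m => hn m
  have hw : F₀ ⋙ E.p = X.p := by
    rw [← s.w, ← Functor.assoc, hF₀, G.w]
  let F' : Hom X E := Hom.ofFunctor F₀ hw (by
    intro R S β x h h'
    have hGm : D.p.IsHomLift β (G.map (X.lift β h)) := G.map_isHomLift inferInstance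
    have hFm := hlift β (X.lift β h) h inferInstance
    have e : Arrow.mk (l (X.pull β h)) = Arrow.mk (E.vert β h' (F.map (X.lift β h) ≫ l x)) := by
      refine hs.eq_of_map_eq ((X.pull_over β h) ▸ hl (X.pull β h)) inferInstance rfl ?_
      rw [hu β (X.lift β h) h inferInstance hFm hGm, hsl]
      have he : IsEqToHom (D.vert β (G.obj_over h) (G.map (X.lift β h))) := by
        obtain ⟨e, he⟩ := G.map_lift β h
        have : D.p.IsHomLift (𝟙 R) (eqToHom e) :=
          (isEqToHom_eqToHom e).isHomLift D.p (G.obj_over (X.pull_over β h))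
        rw [← D.vert_uniq β (G.obj_over h) (G.map (X.lift β h)) (eqToHom e) he.symm]
        exact isEqToHom_eqToHom e
      rw [he.arrow_comp_right]
    refine hs.eq_of_map_eq_of_ends (arrow_right_eq e) rfl ((hn _).trans ?_)
    rw [G.arrow_map_lift, s.arrow_map_lift]
    exact D.arrow_lift_congr _ (ho x).symm _ _)
  refine ⟨F', ⟨{ app := l, naturality := fun x x' m => ?_ }, hl⟩, Hom.ext_functor hF₀, hsl⟩
  refine (Arrow.mk_inj _ _).1 (hs.eq_of_map_eq_of_ends rfl rfl ?_)
  change Arrow.mk (s.map (F.map m ≫ l x')) = Arrow.mk (s.map (l x ≫ n m))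
  rw [s.map_comp, s.map_comp]
  refine (arrow_comp_congr rfl (hsl x')).trans (Eq.trans ?_
    (arrow_comp_congr (hsl x).symm (hn m).symm))
  exact (Arrow.mk_inj _ _).2 (app_naturality α m)

lemma arrow_hom₂_iff {F G G' : Hom X E} (α : F ⟶ G) (α' : F ⟶ G') :
    Arrow.mk α = Arrow.mk α' ↔ G = G' ∧ ∀ x, Arrow.mk (app α x) = Arrow.mk (app α' x) := by
  constructor
  · intro h
    obtain rfl := arrow_right_eq h
    obtain rfl := (Arrow.mk_inj _ _).1 h
    exact ⟨rfl, fun _ => rfl⟩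
  · rintro ⟨rfl, h⟩
    exact (Arrow.mk_inj _ _).2 (hom₂_ext fun x => (Arrow.mk_inj _ _).1 (h x))

/-- A fibrewise discrete opfibration is a discrete opfibration in `Fib(B)`. The 2-cells are lifted
fibre by fibre; the lifts are compatible with the arrows that are not vertical because such an arrow
is a vertical one followed by a chosen lift. -/
lemma IsFibrewiseDiscreteOpfibration.isDiscreteOpfibration {E D : FibCat.{v₁, u₁, v₂, u₂} B}
    {s : E ⟶ D} (hs : IsFibrewiseDiscreteOpfibration s) : TwoCat.IsDiscreteOpfibration s := by
  intro X F G α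
  obtain ⟨F', α', h, hα⟩ := hs.exists_lift_hom₂ F G α
  refine ⟨⟨F', α'⟩, (isHomLift_iff_arrow _ _ _).2 ((arrow_hom₂_iff _ _).2 ⟨h, hα⟩), ?_⟩
  rintro ⟨F₂, α₂⟩ h₂
  obtain ⟨h₂, hα₂⟩ := (arrow_hom₂_iff _ _).1 ((isHomLift_iff_arrow _ _ _).1 h₂)
  have e : ∀ x, Arrow.mk (app α₂ x) = Arrow.mk (app α' x) := fun x =>
    hs.eq_of_map_eq (b := X.p.obj x) (app_isHomLift _ rfl) (app_isHomLift _ rfl) rfl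
      ((hα₂ x).trans (hα x).symm)
  have hF : F₂ = F' := by
    refine Hom.ext_functor (functor_ext_of_arrow fun {x x'} m => ?_)
    refine hs.eq_of_map_eq_of_ends (arrow_right_eq (e x)) (arrow_right_eq (e x')) ?_
    have : (Hom.comp F₂ s).toFunctor = (Hom.comp F' s).toFunctor :=
      congrArg (fun H : Hom X D => H.toFunctor) (h₂.trans h.symm)
    exact congrArg (fun H => Arrow.mk (H.map m)) this
  subst hF
  have : α₂ = α' := hom₂_ext fun x => (Arrow.mk_inj _ _).1 (e x)
  rw [this]

end

end FibCat

namespace FibCat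

variable {B : Type u₁} [Category.{v₁} B]

/-! ### Coidentifiers computed fibrewise -/

section

variable {A Q Z : FibCat.{v₁, u₁, v₂, u₂} B}

/-- A functor defined on the vertical arrows of a cloven fibration only: a family of functors
between the fibres that commute with reindexing. It is presented as an operation on the arrows of
the total category that lie over identities. -/
structure VertFunctor (Q Z : FibCat.{v₁, u₁, v₂, u₂} B) where
  /-- The action on objects. -/
  obj : Q.obj → Z.obj
  /-- The action on the arrows over the identity of `R`. -/
  map (R : B) {x y : Q.obj} (v : x ⟶ y) [Q.p.IsHomLift (𝟙 R) v] : obj x ⟶ obj y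
  obj_over (x : Q.obj) : Z.p.obj (obj x) = Q.p.obj x
  map_isHomLift (R : B) {x y : Q.obj} (v : x ⟶ y) [Q.p.IsHomLift (𝟙 R) v] :
    Z.p.IsHomLift (𝟙 R) (map R v)
  map_id (R : B) (x : Q.obj) [Q.p.IsHomLift (𝟙 R) (𝟙 x)] : map R (𝟙 x) = 𝟙 (obj x)
  map_comp (R : B) {x y z : Q.obj} (v : x ⟶ y) (w : y ⟶ z) [Q.p.IsHomLift (𝟙 R) v]
    [Q.p.IsHomLift (𝟙 R) w] : map R (v ≫ w) = map R v ≫ map R w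
  obj_pull {R S : B} (β : R ⟶ S) {x : Q.obj} (h : Q.p.obj x = S) :
    obj (Q.pull β h) = Z.pull β ((obj_over x).trans h)
  map_reindex {R S : B} (β : R ⟶ S) {x y : Q.obj} (hx : Q.p.obj x = S) (hy : Q.p.obj y = S)
    (v : x ⟶ y) [Q.p.IsHomLift (𝟙 S) v] (w : Q.pull β hx ⟶ Q.pull β hy)
    [Q.p.IsHomLift (𝟙 R) w] (e : w ≫ Q.lift β hy = Q.lift β hx ≫ v) :
    map R w ≫ eqToHom (obj_pull β hy) ≫ Z.lift β ((obj_over y).trans hy) =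
      eqToHom (obj_pull β hx) ≫ Z.lift β ((obj_over x).trans hx) ≫ map S v

namespace VertFunctor

instance (T : VertFunctor Q Z) (R : B) {x y : Q.obj} (v : x ⟶ y) [Q.p.IsHomLift (𝟙 R) v] :
    Z.p.IsHomLift (𝟙 R) (T.map R v) :=
  T.map_isHomLift R v

/-- The extension of a functor on vertical arrows to all arrows: its value at an arrow `m` over `β`
is the value at the vertical part of `m`, followed by the chosen lift of `β`. -/
noncomputable def mapHom (T : VertFunctor Q Z) {R S : B} (β : R ⟶ S) {x y : Q.obj}
    (h : Q.p.obj y = S) (m : x ⟶ y) [Q.p.IsHomLift β m] : T.obj x ⟶ T.obj y :=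
  T.map R (Q.vert β h m) ≫ eqToHom (T.obj_pull β h) ≫ Z.lift β ((T.obj_over y).trans h)

variable (T : VertFunctor Q Z)

lemma mapHom_isHomLift {R S : B} (β : R ⟶ S) {x y : Q.obj} (h : Q.p.obj y = S) (m : x ⟶ y)
    [Q.p.IsHomLift β m] : Z.p.IsHomLift β (T.mapHom β h m) := by
  unfold mapHom
  infer_instance

lemma mapHom_comp_left {R S : B} (β : R ⟶ S) {x' x y : Q.obj} (h : Q.p.obj y = S) (v : x' ⟶ x)
    (m : x ⟶ y) [Q.p.IsHomLift (𝟙 R) v] [Q.p.IsHomLift β m] :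
    T.mapHom β h (v ≫ m) = T.map R v ≫ T.mapHom β h m := by
  have e := Q.vert_uniq β h (v ≫ m) (v ≫ Q.vert β h m) (by rw [Category.assoc, vert_lift])
  unfold mapHom
  simp only [← e, T.map_comp, Category.assoc]

lemma mapHom_lift {R S : B} (β : R ⟶ S) {y : Q.obj} (h : Q.p.obj y = S) :
    T.mapHom β h (Q.lift β h) =
      eqToHom (T.obj_pull β h) ≫ Z.lift β ((T.obj_over y).trans h) := by
  have i : Q.p.IsHomLift (𝟙 R) (𝟙 (Q.pull β h)) := IsHomLift.id (Q.pull_over β h)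
  have e := Q.vert_uniq β h (Q.lift β h) (𝟙 _) (Category.id_comp _)
  unfold mapHom
  simp only [← e, T.map_id, Category.id_comp]

lemma mapHom_eq_vert {R S : B} (β : R ⟶ S) {x y : Q.obj} (h : Q.p.obj y = S) (m : x ⟶ y)
    [Q.p.IsHomLift β m] :
    T.mapHom β h m = T.map R (Q.vert β h m) ≫ T.mapHom β h (Q.lift β h) := by
  rw [mapHom_lift]
  rfl

lemma mapHom_congr {R S R' S' : B} {β : R ⟶ S} {β' : R' ⟶ S'} {x y x' y' : Q.obj}
    {h : Q.p.obj y = S} {h' : Q.p.obj y' = S'} {m : x ⟶ y} {m' : x' ⟶ y'}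
    [i : Q.p.IsHomLift β m] [i' : Q.p.IsHomLift β' m'] (e : Arrow.mk m = Arrow.mk m') :
    Arrow.mk (T.mapHom β h m) = Arrow.mk (T.mapHom β' h' m') := by
  obtain rfl := arrow_left_eq e
  obtain rfl := arrow_right_eq e
  obtain rfl := (Arrow.mk_inj _ _).1 e
  obtain ⟨⟩ := i
  obtain rfl := IsHomLift.domain_eq Q.p β' m
  obtain rfl := IsHomLift.codomain_eq Q.p β' m
  obtain rfl := IsHomLift.eq_of_isHomLift Q.p β' m
  rfl

/-- `T` sends the restriction of `q` to vertical arrows to the restriction of `z`. -/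
structure IsDesc (q : Hom A Q) (z : Hom A Z) : Prop where
  obj_eq (a : A.obj) : T.obj (q.obj a) = z.obj a
  map_eq (R : B) {a a' : A.obj} (φ : a ⟶ a') [A.p.IsHomLift (𝟙 R) φ] :
    Arrow.mk (T.map R (q.map φ)) = Arrow.mk (z.map φ)

section

variable {T} {q : Hom A Q} {z : Hom A Z} (hz : T.IsDesc q z)
include hz

lemma IsDesc.mapHom_map {R S : B} (β : R ⟶ S) {a w : A.obj} (h : A.p.obj w = S) (φ : a ⟶ w)
    [A.p.IsHomLift β φ] :
    Arrow.mk (T.mapHom β (q.obj_over h) (q.map φ)) = Arrow.mk (z.map φ) := by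
  have e₁ : Arrow.mk (T.map R (Q.vert β (q.obj_over h) (q.map φ))) =
      Arrow.mk (T.map R (q.map (A.vert β h φ))) := by
    have e := q.arrow_map_vert β h φ
    have hq := arrow_right_eq e
    have i : Q.p.IsHomLift (𝟙 R) (q.map (A.vert β h φ) ≫ eqToHom hq) := inferInstance
    have e' : Q.vert β (q.obj_over h) (q.map φ) = q.map (A.vert β h φ) ≫ eqToHom hq := by
      rw [← Arrow.mk_inj, Arrow.arrow_mk_comp_eqToHom, e]
    have gen : ∀ {x y y' : Q.obj} (v : x ⟶ y) (v' : x ⟶ y') (_ : Q.p.IsHomLift (𝟙 R) v)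
        (_ : Q.p.IsHomLift (𝟙 R) v') (hy : y = y') (_ : v' = v ≫ eqToHom hy),
        Arrow.mk (T.map R v') = Arrow.mk (T.map R v) := by
      rintro x y y' v v' _ _ rfl h
      obtain rfl : v' = v := by simpa using h
      rfl
    exact gen _ _ _ _ hq e'
  have e₂ : Arrow.mk (z.map φ) = Arrow.mk (z.map (A.vert β h φ) ≫ z.map (A.lift β h)) := by
    rw [← z.map_comp, vert_lift]
  rw [e₂]
  refine arrow_comp_congr (e₁.trans (hz.map_eq R _)) ?_
  rw [Arrow.arrow_mk_eqToHom_comp, z.arrow_map_lift]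
  exact Z.arrow_lift_congr _ (hz.obj_eq w) _ _

variable (hq : Function.Surjective q.obj)
include hq

lemma IsDesc.mapHom_comp {R S S' : B} (β : R ⟶ S) (β' : S ⟶ S') {x y y' : Q.obj}
    (h : Q.p.obj y = S) (h' : Q.p.obj y' = S') (m : x ⟶ y) (n : y ⟶ y')
    [Q.p.IsHomLift β m] [Q.p.IsHomLift β' n] :
    T.mapHom (β ≫ β') h' (m ≫ n) = T.mapHom β h m ≫ T.mapHom β' h' n := by
  -- The composite of two chosen lifts is the image of an arrow of `A`.
  have hlift : T.mapHom (β ≫ β') h' (Q.lift β (Q.pull_over β' h') ≫ Q.lift β' h') =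
      T.mapHom β (Q.pull_over β' h') (Q.lift β (Q.pull_over β' h')) ≫
        T.mapHom β' h' (Q.lift β' h') := by
    obtain ⟨a, rfl⟩ := hq y'
    have ha : A.p.obj a = S' := (q.w_obj a).symm.trans h'
    let l' := A.lift β' ha
    let l := A.lift β (A.pull_over β' ha)
    have hl' : Arrow.mk (q.map l') = Arrow.mk (Q.lift β' h') := q.arrow_map_lift β' ha
    have hl : Arrow.mk (q.map l) = Arrow.mk (Q.lift β (Q.pull_over β' h')) :=
      (q.arrow_map_lift β _).trans (Q.arrow_lift_congr β (q.obj_pull β' ha) _ _)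
    rw [← Arrow.mk_inj]
    refine Eq.trans ?_ ((hz.mapHom_map (β ≫ β') ha (l ≫ l')).trans (Eq.trans ?_
      (arrow_comp_congr ((hz.mapHom_map β (A.pull_over β' ha) l).symm.trans ?_)
        ((hz.mapHom_map β' ha l').symm.trans ?_))))
    · refine T.mapHom_congr ?_
      rw [q.map_comp]
      exact arrow_comp_congr hl.symm hl'.symm
    · rw [z.map_comp]
    · exact T.mapHom_congr hl
    · exact T.mapHom_congr hl'
  let n₀ := Q.vert β' h' n
  let n₁ := Q.vert β (Q.pull_over β' h') (Q.lift β h ≫ n₀)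
  have e : m ≫ n = Q.vert β h m ≫ n₁ ≫ Q.lift β (Q.pull_over β' h') ≫ Q.lift β' h' := by
    simp only [n₁, n₀, vert_lift, vert_lift_assoc, Category.assoc]
  have key : T.map R n₁ ≫ T.mapHom β (Q.pull_over β' h') (Q.lift β (Q.pull_over β' h')) =
      T.mapHom β h (Q.lift β h) ≫ T.map S n₀ := by
    rw [mapHom_lift, mapHom_lift, T.map_reindex β h (Q.pull_over β' h') n₀ n₁
      (Q.vert_lift β _ _), Category.assoc]
  have e' : T.mapHom (β ≫ β') h' (m ≫ n) = T.mapHom (β ≫ β') h'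
      (Q.vert β h m ≫ n₁ ≫ Q.lift β (Q.pull_over β' h') ≫ Q.lift β' h') :=
    (Arrow.mk_inj _ _).1 (T.mapHom_congr (congrArg Arrow.mk e))
  rw [e', mapHom_comp_left, mapHom_comp_left, hlift, T.mapHom_eq_vert β h m,
    T.mapHom_eq_vert β' h' n, ← Category.assoc (T.map R n₁), key]
  simp only [Category.assoc, n₀]

/-- A functor on vertical arrows through which a morphism `z` of cloven fibrations factors along a
morphism `q` that is surjective on objects extends to a morphism of cloven fibrations. The
extension is compatible with the composition of chosen lifts because `z` is and because every
object lies in the image of `q`. -/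
lemma IsDesc.exists_hom : ∃ t : Hom Q Z, Hom.comp q t = z := by
  let F : Q.obj ⥤ Z.obj :=
    { obj := T.obj
      map := fun {x y} m => T.mapHom (Q.p.map m) rfl m
      map_id := fun x => by
        obtain ⟨a, rfl⟩ := hq x
        have e := hz.mapHom_map (A.p.map (𝟙 a)) rfl (𝟙 a)
        have e' : IsEqToHom (T.mapHom (Q.p.map (𝟙 (q.obj a))) rfl (𝟙 (q.obj a))) := by
          refine IsEqToHom.of_arrow_eq (isEqToHom_id (z.obj a)) ?_
          rw [← z.map_id, ← e]
          exact T.mapHom_congr (congrArg Arrow.mk (q.map_id a))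
        exact e'.choose_spec
      map_comp := fun {x y y'} m n => by
        rw [← hz.mapHom_comp hq]
        exact (Arrow.mk_inj _ _).1 (T.mapHom_congr rfl) }
  have hw : F ⋙ Z.p = Q.p := functor_ext_of_arrow fun m =>
    (isHomLift_iff_arrow Z.p _ _).1 (T.mapHom_isHomLift (Q.p.map m) rfl m)
  refine ⟨Hom.ofFunctor F hw ?_, Hom.ext_functor (functor_ext_of_arrow fun {a w} φ => ?_)⟩
  · intro R S β y h h'
    refine Eq.trans ?_ ((congrArg Arrow.mk (T.mapHom_lift β h)).trans
      (Arrow.arrow_mk_eqToHom_comp _ _))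
    exact T.mapHom_congr rfl
  · exact Eq.trans (T.mapHom_congr rfl) (hz.mapHom_map (A.p.map φ) rfl φ)

end

/-- A family of functors between the fibres that commute with reindexing, as a functor on vertical
arrows. -/
noncomputable def ofFiber (T : ∀ b, Q.p.Fiber b ⥤ Z.p.Fiber b)
    (hT : ∀ {R S : B} (β : R ⟶ S), T S ⋙ Z.reindex β = Q.reindex β ⋙ T R) :
    VertFunctor Q Z :=
  have hobj : ∀ {b : B} (x : Q.obj) (h : Q.p.obj x = b),
      ((T (Q.p.obj x)).obj ⟨x, rfl⟩).1 = ((T b).obj ⟨x, h⟩).1 := by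
    rintro b x rfl
    rfl
  have hpull : ∀ {R S : B} (β : R ⟶ S) {x : Q.obj} (h : Q.p.obj x = S),
      ((T (Q.p.obj (Q.pull β h))).obj ⟨Q.pull β h, rfl⟩).1 = Z.pull β ((T S).obj ⟨x, h⟩).2 :=
    fun {R S} β {x} h => (hobj _ (Q.pull_over β h)).trans
      (congrArg (fun F => (F.obj (⟨x, h⟩ : Q.p.Fiber S)).1) (hT β).symm)
  { obj := fun x => ((T (Q.p.obj x)).obj ⟨x, rfl⟩).1
    map := fun R {x y} v i =>
      eqToHom (hobj x (IsHomLift.domain_eq Q.p (𝟙 R) v)) ≫ ((T R).map (fiberHomMk v i)).1 ≫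
        eqToHom (hobj y (IsHomLift.codomain_eq Q.p (𝟙 R) v)).symm
    obj_over := fun x => ((T (Q.p.obj x)).obj ⟨x, rfl⟩).2
    map_isHomLift := fun R {x y} v i =>
      isHomLift_of_arrow_eq Z.p (arrow_conj _ _ _).symm ((T R).map (fiberHomMk v i)).2
    map_id := fun R x i => by
      rw [← Arrow.mk_inj]
      refine (arrow_conj _ _ _).trans ?_
      have e : (fiberHomMk (𝟙 x) i) = 𝟙 _ := rfl
      have e' := (arrow_fiber_iff _ _).1 (congrArg Arrow.mk ((T R).map_id
        (Functor.Fiber.mk (IsHomLift.domain_eq Q.p (𝟙 R) (𝟙 x)))))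
      exact e'.trans (arrow_id_congr (hobj x _).symm)
    map_comp := fun R {x y z} v w i j => by
      rw [← Arrow.mk_inj]
      refine (arrow_conj _ _ _).trans (Eq.trans ?_ (arrow_comp_congr (arrow_conj _ _ _).symm
        (arrow_conj _ _ _).symm))
      exact (arrow_fiber_iff _ _).1 (congrArg Arrow.mk ((T R).map_comp (fiberHomMk v i)
        (fiberHomMk w j)))
    obj_pull := fun β x h => (hpull β h).trans (Z.pull_congr β (hobj x h).symm _ _)
    map_reindex := fun {R S} β {x y} hx hy v i w j e => by
      let X : Q.p.Fiber S := Functor.Fiber.mk hx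
      let Y : Q.p.Fiber S := Functor.Fiber.mk hy
      let φ : X ⟶ Y := ⟨v, i⟩
      have hw : Arrow.mk (fiberHomMk w j) = Arrow.mk ((Q.reindex β).map φ) := by
        refine (arrow_fiber_iff _ _).2 (congrArg Arrow.mk ?_)
        exact Q.vert_ext β hy j ((Q.reindex β).map φ).2 (e.trans (reindex_map_lift β φ).symm)
      have hw' : Arrow.mk ((T R).map (fiberHomMk w j)).1 =
          Arrow.mk ((Z.reindex β).map ((T S).map φ)).1 :=
        ((arrow_fiber_iff _ _).1 (arrow_map_congr hw (T R))).trans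
          (congrArg (fun F => Arrow.mk (F.map φ).1) (hT β).symm)
      have hl := congrArg Arrow.mk (reindex_map_lift β ((T S).map φ))
      rw [← Arrow.mk_inj]
      refine (arrow_comp_congr ((arrow_conj _ _ _).trans hw')
        ((Arrow.arrow_mk_eqToHom_comp _ _).trans
          (Z.arrow_lift_congr β (hobj y hy) _ ((T S).obj Y).2))).trans (hl.trans ?_)
      refine (arrow_comp_congr ?_ (arrow_conj _ _ _).symm).trans
        (Arrow.arrow_mk_eqToHom_comp _ _).symm
      exact Z.arrow_lift_congr β (hobj x hx).symm ((T S).obj X).2 _ }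

lemma ofFiber_obj (T : ∀ b, Q.p.Fiber b ⥤ Z.p.Fiber b)
    (hT : ∀ {R S : B} (β : R ⟶ S), T S ⋙ Z.reindex β = Q.reindex β ⋙ T R) {b : B} {x : Q.obj}
    (h : Q.p.obj x = b) : (ofFiber T hT).obj x = ((T b).obj ⟨x, h⟩).1 := by
  subst h
  rfl

end VertFunctor

/-- The 2-dimensional universal property of a fibrewise coidentifier. The 2-cells obtained on the
fibres are natural for vertical arrows by construction, and for the chosen lifts because these are
images under `q`. -/
lemma existsUnique_hom₂_of_fiber {K : FibCat.{v₁, u₁, v₂, u₂} B} {k₀ k₁ : Hom K A} {κ : k₀ ⟶ k₁}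
    {q : Hom A Q} (hq : Function.Surjective q.obj)
    (H : ∀ b, TwoCat.IsCoidentifier (fiberHom₂ κ b) (fiberHom q b))
    {t t' : Hom Q Z} (β : Hom.comp q t ⟶ Hom.comp q t') :
    ∃! γ : t ⟶ t', BasedCategory.whiskerLeft q.toBasedFunctor γ = β := by
  choose g hg hgu using fun b =>
    (H b).existsUnique_hom₂ (t := fiberHom t b) (t' := fiberHom t' b) (fiberHom₂ β b)
  let G : ∀ x, t.obj x ⟶ t'.obj x := fun x => ((g (Q.p.obj x)).toNatTrans.app ⟨x, rfl⟩).1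
  have hG : ∀ b (x : Q.p.Fiber b), ((g b).toNatTrans.app x).1 = G x.1 := by
    rintro _ ⟨x, rfl⟩
    rfl
  have hGq : ∀ a, G (q.obj a) = app β a := by
    intro a
    rw [← hG (A.p.obj a) ⟨q.obj a, q.w_obj a⟩]
    exact congrArg (fun δ => (δ.toNatTrans.app (⟨a, rfl⟩ : A.p.Fiber (A.p.obj a))).1)
      (hg (A.p.obj a))
  have nat_vert : ∀ {R : B} {x y : Q.obj} (v : x ⟶ y), Q.p.IsHomLift (𝟙 R) v →
      t.map v ≫ G y = G x ≫ t'.map v := by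
    intro R x y v hv
    have := congrArg Subtype.val ((g R).toNatTrans.naturality (fiberHomMk v hv))
    change _ ≫ ((g R).toNatTrans.app _).1 = ((g R).toNatTrans.app _).1 ≫ _ at this
    rw [hG, hG] at this
    exact this
  have nat_lift : ∀ {R S : B} (b : R ⟶ S) {y : Q.obj} (h : Q.p.obj y = S),
      t.map (Q.lift b h) ≫ G y = G _ ≫ t'.map (Q.lift b h) := by
    intro R S b y h
    obtain ⟨a, rfl⟩ := hq y
    have ha : A.p.obj a = S := (q.w_obj a).symm.trans h
    have e : Arrow.mk (q.map (A.lift b ha)) = Arrow.mk (Q.lift b h) := q.arrow_map_lift b ha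
    have hn := app_naturality β (A.lift b ha)
    rw [← hGq, ← hGq] at hn
    rw [← Arrow.mk_inj] at hn ⊢
    have e' : Arrow.mk (G (q.obj (A.pull b ha))) = Arrow.mk (G (Q.pull b h)) := by
      rw [arrow_left_eq e]
    exact (arrow_comp_congr (arrow_map_congr e t.toFunctor).symm rfl).trans
      (hn.trans (arrow_comp_congr e' (arrow_map_congr e t'.toFunctor)))
  refine ⟨⟨{ app := G, naturality := fun x y m => ?_ }, fun x => ?_⟩, ?_, ?_⟩
  · rw [← vert_lift (Q.p.map m) rfl m, t.map_comp, t'.map_comp, Category.assoc, nat_lift,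
      ← Category.assoc, nat_vert (R := Q.p.obj x) _ inferInstance, Category.assoc]
  · exact ((g (Q.p.obj x)).toNatTrans.app ⟨x, rfl⟩).2
  · exact hom₂_ext (F := Hom.comp q t) (G := Hom.comp q t') hGq
  · intro γ' h'
    refine hom₂_ext fun x => ?_
    obtain ⟨a, rfl⟩ := hq x
    refine Eq.trans ?_ (hGq a).symm
    exact congrArg (fun δ => BasedNatTrans.toNatTrans δ |>.app a) h'

/-- A 1-cell of `Fib(B)` that is surjective on objects and restricts to a coidentifier on every
fibre is a coidentifier. -/
lemma isCoidentifier_of_fiber {K A Q : FibCat.{v₁, u₁, v₂, u₂} B} {k₀ k₁ : K ⟶ A} {κ : k₀ ⟶ k₁}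
    {q : A ⟶ Q} (hq : Function.Surjective (Hom.toBasedFunctor q).obj)
    (hκ : TwoCat.IsIdentity (Bicategory.whiskerRight κ q))
    (H : ∀ b, TwoCat.IsCoidentifier (fiberHom₂ κ b) (fiberHom q b)) :
    TwoCat.IsCoidentifier κ q where
  isIdentity := hκ
  existsUnique_hom {Z} z h := by
    have hzb : ∀ b, TwoCat.IsIdentity (Bicategory.whiskerRight (fiberHom₂ κ b) (fiberHom z b)) :=
      fun b => (Cat.isIdentity_iff _).2 fun x =>
        (isEqToHom_fiber_iff _).2 ((isIdentity_iff _).1 h x.1)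
    choose T hT hTu using fun b => (H b).existsUnique_hom (fiberHom z b) (hzb b)
    have hT' : ∀ b, fiberFunctor q b ⋙ (T b).toFunctor = fiberFunctor z b := fun b =>
      congrArg (fun F => F.toFunctor) (hT b)
    have hbeta : ∀ {R S : B} (β : R ⟶ S),
        (T S).toFunctor ⋙ Z.reindex β = Q.reindex β ⋙ (T R).toFunctor := by
      intro R S β
      let r : Z.fiber S ⟶ Z.fiber R := (Z.reindex β).toCatHom
      let r' : Q.fiber S ⟶ Q.fiber R := (Q.reindex β).toCatHom
      have h₁ : TwoCat.IsIdentity (Bicategory.whiskerRight (fiberHom₂ κ S) (fiberHom z S ≫ r)) :=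
        (TwoCat.isIdentity_whiskerRight_comp _ _ _).2 ((hzb S).whiskerRight r)
      have := ((H S).existsUnique_hom _ h₁).unique (y₁ := T S ≫ r) (y₂ := r' ≫ T R)
        (by rw [← hT S]; rfl) (Cat.Hom.ext ?_)
      · exact congrArg (fun F => F.toFunctor) this
      · change (fiberFunctor q S ⋙ Q.reindex β) ⋙ (T R).toFunctor =
          fiberFunctor z S ⋙ Z.reindex β
        rw [fiberFunctor_comp_reindex, fiberFunctor_comp_reindex]
        exact congrArg (fun F => A.reindex β ⋙ F) (hT' R)
    have hdesc : (VertFunctor.ofFiber (fun b => (T b).toFunctor) hbeta).IsDesc q z :=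
      { obj_eq := fun a => by
          have := VertFunctor.ofFiber_obj (fun b => (T b).toFunctor) hbeta
            (Hom.obj_over q (a := a) rfl)
          exact this.trans (congrArg (fun F => (F.obj (⟨a, rfl⟩ : A.p.Fiber _)).1)
            (hT' (A.p.obj a)))
        map_eq := fun R a a' φ hφ =>
          (arrow_conj _ _ _).trans (congrArg (fun F => Arrow.mk (F.map (fiberHomMk φ hφ)).1)
            (hT' R)) }
    obtain ⟨t, ht⟩ := hdesc.exists_hom hq
    refine ⟨t, ht, fun t' ht' => ?_⟩
    have e : Hom.comp q t' = Hom.comp q t := Eq.trans ht' ht.symm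
    obtain ⟨γ, hγ, -⟩ := existsUnique_hom₂_of_fiber hq H (eqToHom e)
    have := (isIdentity_iff (F := t') (G := t) γ).2 fun y => by
      obtain ⟨a, rfl⟩ := hq y
      have h₁ := (isIdentity_iff (A := A) (C := Z) (F := Hom.comp q t') (G := Hom.comp q t)
        (eqToHom e)).1 ⟨e, rfl⟩ a
      rw [← hγ] at h₁
      exact h₁
    exact this.choose
  existsUnique_hom₂ {Z t t'} β := existsUnique_hom₂_of_fiber hq H β

end

end FibCat

/-! ### The identee -/

namespace CategoryTheory.Functor

section

universe vA uA vC uC vX uX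

variable {A : Type uA} [Category.{vA} A] {C : Type uC} [Category.{vC} C] (p : A ⥤ C)
  {X : Type uX} [Category.{vX} X]

/-- The objects of the identee of a functor `p`: the arrows that `p` maps to identities. -/
structure Identee where
  /-- The source of the arrow. -/
  src : A
  /-- The target of the arrow. -/
  tgt : A
  /-- The arrow. -/
  hom : src ⟶ tgt
  isEqToHom : IsEqToHom (p.map hom)

namespace Identee

variable {p}

/-- The arrows of the identee: commutative squares. -/
@[ext]
structure Hom (K L : Identee p) where
  /-- The arrow between the sources. -/
  left : K.src ⟶ L.src
  /-- The arrow between the targets. -/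
  right : K.tgt ⟶ L.tgt
  w : left ≫ L.hom = K.hom ≫ right

instance : Category (Identee p) where
  Hom := Hom
  id K := ⟨𝟙 _, 𝟙 _, by simp⟩
  comp f g := ⟨f.left ≫ g.left, f.right ≫ g.right, by
    rw [Category.assoc, g.w, ← Category.assoc, f.w, Category.assoc]⟩
  id_comp _ := Hom.ext (Category.id_comp _) (Category.id_comp _)
  comp_id _ := Hom.ext (Category.comp_id _) (Category.comp_id _)
  assoc _ _ _ := Hom.ext (Category.assoc _ _ _) (Category.assoc _ _ _)

lemma hom_ext {K L : Identee p} {f g : K ⟶ L} (hl : f.left = g.left) (hr : f.right = g.right) :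
    f = g :=
  Hom.ext hl hr

lemma obj_ext {K L : Identee p} (h : Arrow.mk K.hom = Arrow.mk L.hom) : K = L := by
  obtain ⟨a, a', φ, _⟩ := K
  obtain ⟨b, b', ψ, _⟩ := L
  dsimp only at h
  obtain rfl := arrow_left_eq h
  obtain rfl := arrow_right_eq h
  obtain rfl := (Arrow.mk_inj _ _).1 h
  rfl

lemma arrow_ext {K L K' L' : Identee p} {f : K ⟶ L} {f' : K' ⟶ L'}
    (hK : Arrow.mk K.hom = Arrow.mk K'.hom) (hL : Arrow.mk L.hom = Arrow.mk L'.hom)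
    (hl : Arrow.mk f.left = Arrow.mk f'.left) (hr : Arrow.mk f.right = Arrow.mk f'.right) :
    Arrow.mk f = Arrow.mk f' := by
  obtain rfl := obj_ext hK
  obtain rfl := obj_ext hL
  exact congrArg Arrow.mk (hom_ext ((Arrow.mk_inj _ _).1 hl) ((Arrow.mk_inj _ _).1 hr))

variable (p)

/-- The source functor. -/
def srcFunctor : Identee p ⥤ A where
  obj K := K.src
  map f := f.left

/-- The target functor. -/
def tgtFunctor : Identee p ⥤ A where
  obj K := K.tgt
  map f := f.right

variable {p}

/-- The functor into the identee determined by a natural transformation. -/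
def lift {F G : X ⥤ A} (ξ : F ⟶ G) (h : ∀ x, IsEqToHom (p.map (ξ.app x))) : X ⥤ Identee p where
  obj x := ⟨F.obj x, G.obj x, ξ.app x, h x⟩
  map f := ⟨F.map f, G.map f, ξ.naturality f⟩
  map_id x := hom_ext (F.map_id x) (G.map_id x)
  map_comp f g := hom_ext (F.map_comp f g) (G.map_comp f g)

end Identee

end

end CategoryTheory.Functor

namespace FibCat

open Functor

variable {B : Type u₁} [Category.{v₁} B]

section

variable {A C : FibCat.{v₁, u₁, v₂, u₂} B}

lemma Hom.isEqToHom_over (p : Hom A C) {a a' : A.obj} {φ : a ⟶ a'} (h : IsEqToHom (p.map φ)) :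
    IsEqToHom (A.p.map φ) := by
  have e : Arrow.mk (C.p.map (p.map φ)) = Arrow.mk (A.p.map φ) :=
    congrArg (fun F => Arrow.mk (F.map φ)) p.w
  exact (h.map C.p).of_arrow_eq e

lemma Hom.vertical (p : Hom A C) {a a' : A.obj} {φ : a ⟶ a'} (h : IsEqToHom (p.map φ)) {R : B}
    (ha : A.p.obj a = R) : A.p.IsHomLift (𝟙 R) φ := by
  subst ha
  rw [isHomLift_iff_arrow, ← (p.isEqToHom_over h).arrow_comp_right, Category.id_comp]

lemma isEqToHom_vert (C : FibCat.{v₁, u₁, v₂, u₂} B) {R S : B} (β : R ⟶ S) {a b b' : C.obj}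
    (h : C.p.obj b' = S) (h' : C.p.obj b = S) (φ : b ⟶ b') (hφ : IsEqToHom φ) (m : a ⟶ b')
    [C.p.IsHomLift β m] (hm : Arrow.mk m = Arrow.mk (C.lift β h')) :
    IsEqToHom (C.vert β h m) := by
  obtain ⟨rfl, -⟩ := hφ
  obtain rfl := arrow_left_eq hm
  obtain rfl := (Arrow.mk_inj _ _).1 hm
  have := IsHomLift.id (C.pull_over β h)
  rw [← C.vert_uniq β h (C.lift β h') (𝟙 _) (Category.id_comp _)]
  exact isEqToHom_id _

/-- The reindexing of an arrow over an identity of `C` lies over an identity of `C`. -/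
lemma Hom.isEqToHom_map_vert (p : Hom A C) {R S : B} (β : R ⟶ S) {a a' : A.obj}
    (h : A.p.obj a = S) (h' : A.p.obj a' = S) (φ : a ⟶ a') (hφ : IsEqToHom (p.map φ))
    [A.p.IsHomLift β (A.lift β h ≫ φ)] :
    IsEqToHom (p.map (A.vert β h' (A.lift β h ≫ φ))) := by
  refine IsEqToHom.of_arrow_eq ?_ (p.arrow_map_vert β h' (A.lift β h ≫ φ)).symm
  refine C.isEqToHom_vert β _ (p.obj_over h) (p.map φ) hφ _ ?_
  rw [p.map_comp, hφ.arrow_comp_right, p.arrow_map_lift]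

lemma identee_right_isHomLift (p : Hom A C) {K L : Identee p.toFunctor} (f : K ⟶ L) {R S : B}
    {β : R ⟶ S} (h : A.p.IsHomLift β f.left) : A.p.IsHomLift β f.right := by
  rw [isHomLift_iff_arrow] at h ⊢
  rw [← h, ← (p.isEqToHom_over L.isEqToHom).arrow_comp_right, ← A.p.map_comp, f.w,
    A.p.map_comp, (p.isEqToHom_over K.isEqToHom).arrow_comp_left]

lemma identee_tgt_over (p : Hom A C) {S : B} {K : Identee p.toFunctor} (h : A.p.obj K.src = S) :
    A.p.obj K.tgt = S :=
  have : A.p.IsHomLift (𝟙 S) K.hom := p.vertical K.isEqToHom h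
  IsHomLift.codomain_eq A.p (𝟙 S) K.hom

/-- The reindexing of an object of the identee. -/
noncomputable def identeePull (p : Hom A C) {R S : B} (β : R ⟶ S) {K : Identee p.toFunctor}
    (h : A.p.obj K.src = S) : Identee p.toFunctor :=
  have _ : A.p.IsHomLift (𝟙 S) K.hom := p.vertical K.isEqToHom h
  have h' := identee_tgt_over p h
  ⟨A.pull β h, A.pull β h', A.vert β h' (A.lift β h ≫ K.hom),
    p.isEqToHom_map_vert β h h' K.hom K.isEqToHom⟩

/-- The chosen cartesian arrow of the identee. -/
noncomputable def identeeLift (p : Hom A C) {R S : B} (β : R ⟶ S) {K : Identee p.toFunctor}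
    (h : A.p.obj K.src = S) : identeePull p β h ⟶ K :=
  have _ : A.p.IsHomLift (𝟙 S) K.hom := p.vertical K.isEqToHom h
  ⟨A.lift β h, A.lift β (identee_tgt_over p h),
    (vert_lift β (identee_tgt_over p h) (A.lift β h ≫ K.hom)).symm⟩

lemma identee_isHomLift_iff (p : Hom A C) {R S : B} (β : R ⟶ S) {K L : Identee p.toFunctor}
    (f : K ⟶ L) :
    (Identee.srcFunctor p.toFunctor ⋙ A.p).IsHomLift β f ↔ A.p.IsHomLift β f.left := by
  rw [isHomLift_iff_arrow, isHomLift_iff_arrow]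
  rfl

lemma existsUnique_identeeLift (p : Hom A C) {R S : B} (β : R ⟶ S) {K : Identee p.toFunctor}
    (h : A.p.obj K.src = S) {R' : B} (g : R' ⟶ R) {K' : Identee p.toFunctor} (f : K' ⟶ K)
    (hl : A.p.IsHomLift (g ≫ β) f.left) :
    ∃! χ : K' ⟶ identeePull p β h, A.p.IsHomLift g χ.left ∧ χ ≫ identeeLift p β h = f := by
  have i : A.p.IsHomLift (𝟙 S) K.hom := p.vertical K.isEqToHom h
  have hr : A.p.IsHomLift (g ≫ β) f.right := identee_right_isHomLift p f hl
  have h' := identee_tgt_over p h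
  have i' : A.p.IsHomLift (𝟙 R') K'.hom :=
    p.vertical K'.isEqToHom (IsHomLift.domain_eq A.p (g ≫ β) f.left)
  let l := IsStronglyCartesian.map A.p β (A.lift β h) (g := g) rfl f.left
  let r := IsStronglyCartesian.map A.p β (A.lift β h') (g := g) rfl f.right
  have hll : l ≫ A.lift β h = f.left := IsStronglyCartesian.fac A.p β _ rfl _
  have hrr : r ≫ A.lift β h' = f.right := IsStronglyCartesian.fac A.p β _ rfl _
  have w : l ≫ A.vert β h' (A.lift β h ≫ K.hom) = K'.hom ≫ r := by
    refine IsStronglyCartesian.ext A.p β (A.lift β h') g ?_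
    rw [Category.assoc, vert_lift, Category.assoc, hrr, ← Category.assoc, hll]
    exact f.w
  refine ⟨⟨l, r, w⟩, ⟨?_, Identee.hom_ext hll hrr⟩, ?_⟩
  · exact IsStronglyCartesian.map_isHomLift A.p β (A.lift β h) rfl f.left
  · rintro f' ⟨hl', e⟩
    have hr' : A.p.IsHomLift g f'.right := identee_right_isHomLift p f' hl'
    exact Identee.hom_ext
      (@IsStronglyCartesian.map_uniq _ _ _ _ A.p _ _ _ _ β (A.lift β h) _ _ _ g _ rfl f.left _
        f'.left hl' (congrArg (fun f => f.left) e))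
      (@IsStronglyCartesian.map_uniq _ _ _ _ A.p _ _ _ _ β (A.lift β h') _ _ _ g _ rfl f.right _
        f'.right hr' (congrArg (fun f => f.right) e))

end

section

variable {A C : FibCat.{v₁, u₁, v₂, max u₂ v₂} B}

/-- The identee of a morphism of cloven fibrations, with the cleavage computed on sources and on
targets. -/
noncomputable abbrev identee (p : Hom A C) : FibCat.{v₁, u₁, v₂, max u₂ v₂} B where
  toBasedCategory := BasedCategory.ofFunctor (Identee.srcFunctor p.toFunctor ⋙ A.p)
  pull := fun {_ _} β {K} h => identeePull p β (K := K) (show A.p.obj K.src = _ from h)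
  lift := fun {_ _} β {K} h => identeeLift p β (K := K) (show A.p.obj K.src = _ from h)
  isStronglyCartesian_lift {R S} β K h :=
    { toIsHomLift := (identee_isHomLift_iff p _ _).2 (A.isStronglyCartesian_lift β h).toIsHomLift
      universal_property' := by
        intro K' g f hf
        obtain ⟨χ, ⟨h₁, h₂⟩, h₃⟩ := existsUnique_identeeLift p β (K := K) h g f
          ((identee_isHomLift_iff p _ _).1 hf)
        exact ⟨χ, ⟨(identee_isHomLift_iff p _ _).2 h₁, h₂⟩, fun χ' h' =>
          h₃ χ' ⟨(identee_isHomLift_iff p _ _).1 h'.1, h'.2⟩⟩ }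

/-- The source morphism of the identee. -/
noncomputable def identeeSrc (p : Hom A C) : Hom (identee p) A :=
  Hom.ofFunctor (A := identee p) (Identee.srcFunctor p.toFunctor) rfl fun _ _ _ _ => rfl

/-- The target morphism of the identee. -/
noncomputable def identeeTgt (p : Hom A C) : Hom (identee p) A :=
  Hom.ofFunctor (A := identee p) (Identee.tgtFunctor p.toFunctor)
    (functor_ext_of_arrow fun f => (isHomLift_iff_arrow A.p _ _).1
      (identee_right_isHomLift p (β := A.p.map (Identee.Hom.left f)) f (IsHomLift.map A.p _)))
    fun _ _ _ _ => rfl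

/-- The universal 2-cell of the identee. -/
noncomputable def identeeCell (p : Hom A C) : identeeSrc p ⟶ identeeTgt p :=
  { app := fun K => K.hom
    naturality := fun _ _ f => f.w
    isHomLift' := fun K => p.vertical K.isEqToHom rfl }

/-- The morphism into the identee determined by a 2-cell. -/
noncomputable def identeeDesc (p : Hom A C) {X : FibCat.{v₁, u₁, v₂, max u₂ v₂} B}
    {F G : Hom X A} (ξ : F ⟶ G) (h : ∀ x, IsEqToHom (p.map (app ξ x))) : Hom X (identee p) :=
  Hom.ofFunctor (C := identee p) (Identee.lift (p := p.toFunctor) ξ.toNatTrans h) F.w (by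
    intro R S β x hx hx'
    have i : X.p.IsHomLift β (X.lift β hx) := inferInstance
    have iF : A.p.IsHomLift β (F.map (X.lift β hx)) := F.map_isHomLift i
    have iξ : A.p.IsHomLift (𝟙 S) (app ξ x) := app_isHomLift ξ hx
    have iξ' : A.p.IsHomLift (𝟙 R) (app ξ (X.pull β hx)) := app_isHomLift ξ (X.pull_over β hx)
    refine Identee.arrow_ext ?_ rfl (F.arrow_map_lift β hx) (G.arrow_map_lift β hx)
    have hG := G.obj_over hx
    have e : A.vert β hG (F.map (X.lift β hx) ≫ app ξ x) =
        app ξ (X.pull β hx) ≫ eqToHom (G.obj_pull β hx) := by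
      refine (A.vert_uniq β hG _ _ ?_).symm
      rw [app_naturality, Category.assoc, ← Arrow.mk_inj]
      refine arrow_comp_congr rfl ?_
      rw [Arrow.arrow_mk_eqToHom_comp, G.arrow_map_lift]
    change Arrow.mk (app ξ (X.pull β hx)) = _
    rw [← Arrow.arrow_mk_comp_eqToHom _ (G.obj_pull β hx), ← e]
    exact A.arrow_vert_congr β _ _ _ (A.lift β (F.obj_over hx) ≫ app ξ x)
      (arrow_comp_congr (F.arrow_map_lift β hx) rfl))

lemma isIdentee_identeeCell {A C : FibCat.{v₁, u₁, v₂, max u₂ v₂} B} (p : A ⟶ C) :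
    TwoCat.IsIdentee p (identeeCell p) where
  isIdentity := (isIdentity_iff _).2 fun K => K.isEqToHom
  existsUnique_hom {X x₀ x₁} ξ hξ := by
    refine ⟨identeeDesc p ξ ((isIdentity_iff _).1 hξ),
      ⟨Hom.ext_functor rfl, Hom.ext_functor rfl, ?_⟩, ?_⟩
    · exact (Category.id_comp _).symm.trans (congrArg _ (Category.comp_id _).symm)
    · rintro t ⟨rfl, rfl, e⟩
      obtain rfl : Bicategory.whiskerLeft t (identeeCell p) = ξ :=
        e.trans ((Category.id_comp _).trans (Category.comp_id _))
      exact Hom.ext_functor rfl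
  existsUnique_hom₂ {X t t'} α₀ α₁ h := by
    refine ⟨⟨{ app := fun x => ⟨app α₀ x, app α₁ x,
                  (congrArg (fun δ => BasedNatTrans.toNatTrans δ |>.app x) h).symm⟩
               naturality := fun x y f => ?_ }, fun x => ?_⟩, ⟨rfl, rfl⟩, ?_⟩
    · exact Identee.hom_ext (app_naturality α₀ f) (app_naturality α₁ f)
    · exact (identee_isHomLift_iff p _ _).2 (app_isHomLift α₀ rfl)
    · rintro γ ⟨rfl, rfl⟩
      rfl

/-- The fibres of the identee are the identees of the functors between the fibres. -/
lemma isIdentee_fiberHom₂_identeeCell {A C : FibCat.{v₁, u₁, v₂, max u₂ v₂} B} (p : A ⟶ C)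
    (b : B) : TwoCat.IsIdentee (fiberHom p b) (fiberHom₂ (identeeCell p) b) where
  isIdentity := (Cat.isIdentity_iff _).2 fun K => (isEqToHom_fiber_iff _).2 K.1.isEqToHom
  existsUnique_hom {X x₀ x₁} ξ hξ := by
    let t : X ⟶ (identee p).fiber b := Functor.toCatHom
      { obj := fun x => ⟨⟨(x₀.toFunctor.obj x).1, (x₁.toFunctor.obj x).1, (ξ.toNatTrans.app x).1,
          (isEqToHom_fiber_iff _).1 ((Cat.isIdentity_iff _).1 hξ x)⟩, (x₀.toFunctor.obj x).2⟩
        map := fun f => ⟨⟨(x₀.toFunctor.map f).1, (x₁.toFunctor.map f).1,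
          congrArg Subtype.val (ξ.toNatTrans.naturality f)⟩,
          (identee_isHomLift_iff p _ _).2 (x₀.toFunctor.map f).2⟩
        map_id := fun x => Subtype.ext (Identee.hom_ext
          (congrArg Subtype.val (x₀.toFunctor.map_id x))
          (congrArg Subtype.val (x₁.toFunctor.map_id x)))
        map_comp := fun f g => Subtype.ext (Identee.hom_ext
          (congrArg Subtype.val (x₀.toFunctor.map_comp f g))
          (congrArg Subtype.val (x₁.toFunctor.map_comp f g))) }
    refine ⟨t, ⟨Cat.Hom.ext rfl, Cat.Hom.ext rfl, ?_⟩, ?_⟩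
    · exact (Category.id_comp _).symm.trans (congrArg _ (Category.comp_id _).symm)
    · rintro t' ⟨rfl, rfl, e⟩
      obtain rfl : Bicategory.whiskerLeft t' (fiberHom₂ (identeeCell p) b) = ξ :=
        e.trans ((Category.id_comp _).trans (Category.comp_id _))
      exact Cat.Hom.ext rfl
  existsUnique_hom₂ {X t t'} α₀ α₁ h := by
    refine ⟨NatTrans.toCatHom₂
      { app := fun x => ⟨⟨(α₀.toNatTrans.app x).1, (α₁.toNatTrans.app x).1,
            (congrArg (fun δ => (δ.toNatTrans.app x).1) h).symm⟩,
          (identee_isHomLift_iff p _ _).2 (α₀.toNatTrans.app x).2⟩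
        naturality := fun x y f => ?_ }, ⟨rfl, rfl⟩, ?_⟩
    · exact Subtype.ext (Identee.hom_ext
        (congrArg Subtype.val (α₀.toNatTrans.naturality f))
        (congrArg Subtype.val (α₁.toNatTrans.naturality f)))
    · rintro γ ⟨rfl, rfl⟩
      rfl

end

end FibCat

/-! ### The fibration of components -/

namespace FibCat

open Functor

variable {B : Type u₁} [Category.{v₁} B]

section

variable {A C : FibCat.{v₁, u₁, v₂, u₂} B} {p : Hom A C}

/-- The objects of the fibration of components of `p`: the connected components of the fibres of
`p` over the objects of `C`. The hypothesis on `p` is recorded in the type, because composition of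
arrows depends on it. -/
def Components (p : Hom A C) (_ : IsFibrewiseOpfibration p) : Type u₂ :=
  Quot p.toFunctor.VertRel

namespace Components

variable {hp : IsFibrewiseOpfibration p}

/-- The component of an object. -/
def cls (hp : IsFibrewiseOpfibration p) (a : A.obj) : Components p hp :=
  Quot.mk _ a

lemma cls_surjective (x : Components p hp) : ∃ a, cls hp a = x :=
  Quot.exists_rep x

lemma cls_eq_of {a a' : A.obj} (φ : a ⟶ a') (h : IsEqToHom (p.map φ)) : cls hp a = cls hp a' :=
  Quot.sound ⟨φ, h⟩

lemma eqvGen {a a' : A.obj} (h : cls hp a = cls hp a') :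
    Relation.EqvGen p.toFunctor.VertRel a a' :=
  Quot.eqvGen_exact h

/-- The object of `C` over which a component lies. -/
def base (x : Components p hp) : C.obj :=
  Quot.lift (fun a => p.obj a) (fun _ _ ⟨_, h⟩ => h.choose) x

/-- Two objects of `A` over `b` in the same component are connected inside a fibre of `p_b`: a
zigzag of arrows over identities of `C` consists of arrows over identities of `B`. -/
lemma eqvGen_fiber {a a' : A.obj} (h : cls hp a = cls hp a') {b : B} (ha : A.p.obj a = b)
    (ha' : A.p.obj a' = b) :
    Relation.EqvGen (fiberFunctor p b).VertRel (Fiber.mk ha) (Fiber.mk ha') := by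
  have key : ∀ {a a' : A.obj} (_ : Relation.EqvGen p.toFunctor.VertRel a a'),
      A.p.obj a = A.p.obj a' ∧ ∀ {b : B} (ha : A.p.obj a = b) (ha' : A.p.obj a' = b),
        Relation.EqvGen (fiberFunctor p b).VertRel (Fiber.mk ha) (Fiber.mk ha') := by
    intro a a' h
    induction h with
    | rel a a' h =>
      obtain ⟨φ, hφ⟩ := h
      refine ⟨(p.isEqToHom_over hφ).choose, fun {b} ha ha' => Relation.EqvGen.rel _ _ ?_⟩
      have i := p.vertical hφ ha
      exact ⟨fiberHomMk φ i, (isEqToHom_fiber_iff _).2 hφ⟩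
    | refl a => exact ⟨rfl, fun _ _ => Relation.EqvGen.refl _⟩
    | symm a a' _ ih => exact ⟨ih.1.symm, fun ha ha' => (ih.2 ha' ha).symm⟩
    | trans a a' a'' _ _ ih ih' =>
      exact ⟨ih.1.trans ih'.1, fun ha ha' =>
        (ih.2 ha (ih.1.symm.trans ha)).trans _ _ _ (ih'.2 _ ha')⟩
  exact (key (eqvGen h)).2 ha ha'

/-- `f` carries the component `x` to the component `y`: some arrow of `A` over `f` starts in `x` and
ends in `y`. -/
def Carries (f : Arrow C.obj) (x y : Components p hp) : Prop :=
  ∃ (a w : A.obj) (φ : a ⟶ w), cls hp a = x ∧ cls hp w = y ∧ Arrow.mk (p.map φ) = f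

lemma isHomLift_of_arrow {a w : A.obj} {φ : a ⟶ w} {c d : C.obj} {v : c ⟶ d} {R S : B}
    {β : R ⟶ S} (h : C.p.IsHomLift β v) (e : Arrow.mk (p.map φ) = Arrow.mk v) :
    A.p.IsHomLift β φ :=
  have := isHomLift_of_arrow_eq C.p e.symm h
  BasedFunctor.isHomLift_map p.toBasedFunctor β φ

/-- The target component of an arrow over an identity depends only on its image in `C` and on the
source component. -/
lemma cls_target_eq {a a' w w' : A.obj} (φ : a ⟶ w) (φ' : a' ⟶ w') {c d : C.obj} {v : c ⟶ d}
    {b : B} (hv : C.p.IsHomLift (𝟙 b) v) (h : cls hp a = cls hp a')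
    (e : Arrow.mk (p.map φ) = Arrow.mk v) (e' : Arrow.mk (p.map φ') = Arrow.mk v) :
    cls hp w = cls hp w' := by
  have i := isHomLift_of_arrow hv e
  have i' := isHomLift_of_arrow hv e'
  refine (hp b).invariant_eq (fun {_ w} _ => cls hp w.1) ?_ ?_
    (eqvGen_fiber h (IsHomLift.domain_eq A.p (𝟙 b) φ) (IsHomLift.domain_eq A.p (𝟙 b) φ'))
    (fiberHomMk φ i) (fiberHomMk φ' i') ((arrow_fiber_iff _ _).2 (e.trans e'.symm))
  · intro a w w' φ θ hθ
    exact (cls_eq_of θ.1 ((isEqToHom_fiber_iff _).1 hθ)).symm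
  · intro a a' w θ φ _
    rfl

/-- Vertical arrows of `C` lift to `A`. -/
lemma exists_lift (hp : IsFibrewiseOpfibration p) {a : A.obj} {c d : C.obj} {v : c ⟶ d}
    {b : B} (hv : C.p.IsHomLift (𝟙 b) v) (h : p.obj a = c) :
    ∃ (w : A.obj) (φ : a ⟶ w), Arrow.mk (p.map φ) = Arrow.mk v := by
  subst h
  have ha : A.p.obj a = b := (p.w_obj a).symm.trans (IsHomLift.domain_eq C.p (𝟙 b) v)
  obtain ⟨w, φ, hφ, -⟩ := (hp b).exists_lift (fiberHomMk v hv) (a := Fiber.mk ha) rfl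
  exact ⟨w.1, φ.1, (arrow_fiber_iff _ _).1 hφ⟩

/-- The arrow that witnesses `Carries` can be chosen to start at any representative of the source.
-/
lemma Carries.exists_hom {c d : C.obj} {v : c ⟶ d} {b : B} {a : A.obj} {y : Components p hp}
    (H : Carries (Arrow.mk v) (cls hp a) y) (hv : C.p.IsHomLift (𝟙 b) v) :
    ∃ (w : A.obj) (φ : a ⟶ w), cls hp w = y ∧ Arrow.mk (p.map φ) = Arrow.mk v := by
  obtain ⟨a', w', φ', h, rfl, e⟩ := H
  have hc : p.obj a = c := (congrArg base h).symm.trans (arrow_left_eq e)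
  obtain ⟨w, φ, hφ⟩ := exists_lift hp hv hc
  exact ⟨w, φ, cls_target_eq φ φ' hv h.symm hφ e, hφ⟩

lemma Carries.unique {c d : C.obj} {v : c ⟶ d} {b : B} {x y y' : Components p hp}
    (H : Carries (Arrow.mk v) x y) (H' : Carries (Arrow.mk v) x y')
    (hv : C.p.IsHomLift (𝟙 b) v) : y = y' := by
  obtain ⟨a, w, φ, h, rfl, e⟩ := H
  obtain ⟨a', w', φ', h', rfl, e'⟩ := H'
  exact cls_target_eq φ φ' hv (h.trans h'.symm) e e'

lemma Carries.trans {c d d' : C.obj} {v : c ⟶ d} {v' : d ⟶ d'} {b : B}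
    {x y z : Components p hp} (H : Carries (Arrow.mk v) x y) (H' : Carries (Arrow.mk v') y z)
    (hv : C.p.IsHomLift (𝟙 b) v') : Carries (Arrow.mk (v ≫ v')) x z := by
  obtain ⟨a, w, φ, rfl, rfl, e⟩ := H
  obtain ⟨w', φ', rfl, e'⟩ := H'.exists_hom hv
  refine ⟨a, w', φ ≫ φ', rfl, rfl, ?_⟩
  rw [p.map_comp]
  exact arrow_comp_congr e e'

lemma carries_map {a w : A.obj} (φ : a ⟶ w) :
    Carries (Arrow.mk (p.map φ)) (cls hp a) (cls hp w) :=
  ⟨a, w, φ, rfl, rfl, rfl⟩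

lemma carries_eqToHom {c : C.obj} (x : Components p hp) (h : base x = c) :
    Carries (Arrow.mk (eqToHom h)) x x := by
  subst h
  obtain ⟨a, rfl⟩ := cls_surjective (hp := hp) x
  refine ⟨a, a, 𝟙 a, rfl, rfl, ?_⟩
  rw [p.map_id]
  rfl

/-- Reindexing preserves arrows over identities of `C`, hence is well defined on components. -/
lemma cls_pull_eq {R S : B} (β : R ⟶ S) {a a' : A.obj} (h : cls hp a = cls hp a')
    (ha : A.p.obj a = S) (ha' : A.p.obj a' = S) :
    cls hp (A.pull β ha) = cls hp (A.pull β ha') := by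
  have := eqvGen_fiber h ha ha'
  have key : ∀ {x y : A.p.Fiber S}, Relation.EqvGen (fiberFunctor p S).VertRel x y →
      cls hp (A.pull β x.2) = cls hp (A.pull β y.2) := by
    intro x y h
    induction h with
    | rel x y h =>
      obtain ⟨φ, hφ⟩ := h
      have i := φ.2
      have i' : A.p.IsHomLift β (A.lift β x.2 ≫ φ.1) :=
        IsHomLift.comp_lift_id_right A.p β (A.lift β x.2) φ.1
      exact cls_eq_of _ (p.isEqToHom_map_vert β x.2 y.2 φ.1 ((isEqToHom_fiber_iff _).1 hφ))
    | refl x => rfl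
    | symm _ _ _ ih => exact ih.symm
    | trans _ _ _ _ _ ih ih' => exact ih.trans ih'
  exact key this

lemma out_over {S : B} {x : Components p hp} (h : C.p.obj (base x) = S) :
    A.p.obj (Quot.out x) = S := by
  have : base (cls hp (Quot.out x)) = base x := congrArg base (Quot.out_eq x)
  rw [← h, ← this]
  exact (p.w_obj _).symm

/-- The reindexing of a component. -/
noncomputable def pull {R S : B} (β : R ⟶ S) {x : Components p hp}
    (h : C.p.obj (base x) = S) : Components p hp :=
  cls hp (A.pull β (out_over h))

lemma pull_cls {R S : B} (β : R ⟶ S) {a : A.obj} (h : C.p.obj (base (cls hp a)) = S)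
    (ha : A.p.obj a = S) : pull β h = cls hp (A.pull β ha) :=
  cls_pull_eq β (Quot.out_eq (cls hp a)) _ _

lemma base_pull {R S : B} (β : R ⟶ S) {x : Components p hp} (h : C.p.obj (base x) = S) :
    base (pull β h) = C.pull β h := by
  obtain ⟨a, rfl⟩ := cls_surjective (hp := hp) x
  have ha : A.p.obj a = S := (p.w_obj a).symm.trans h
  rw [pull_cls β h ha]
  exact p.obj_pull β ha

/-- The arrows of `C` that underlie an arrow of the fibration of components: those whose vertical
part carries the source to the reindexing of the target. -/
structure IsHom {x y : Components p hp} (γ : base x ⟶ base y) : Prop where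
  carries_vert : ∀ {R S : B} (β : R ⟶ S) (h : C.p.obj (base y) = S) [C.p.IsHomLift β γ],
    Carries (Arrow.mk (C.vert β h γ)) x (pull β h)

/-- The condition `IsHom` may be checked on one choice of the arrow of `B` under `γ`. -/
lemma IsHom.of {x y : Components p hp} {γ : base x ⟶ base y} {R S : B} (β : R ⟶ S)
    (h : C.p.obj (base y) = S) [i : C.p.IsHomLift β γ]
    (H : Carries (Arrow.mk (C.vert β h γ)) x (pull β h)) : IsHom γ := by
  refine ⟨fun {R' S'} β' h' i' => ?_⟩
  subst h h'
  obtain rfl := IsHomLift.domain_eq C.p β γ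
  obtain rfl := IsHomLift.domain_eq C.p β' γ
  obtain rfl := IsHomLift.eq_of_isHomLift C.p β γ
  obtain rfl := IsHomLift.eq_of_isHomLift C.p β' γ
  exact H

lemma isHom_map {a a' : A.obj} (φ : a ⟶ a') :
    IsHom (x := cls hp a) (y := cls hp a') (p.map φ) := by
  refine ⟨fun {R S} β h i => ?_⟩
  have i₀ : C.p.IsHomLift β (p.map φ) := i
  have i' : A.p.IsHomLift β φ := BasedFunctor.isHomLift_map p.toBasedFunctor β φ
  have ha' : A.p.obj a' = S := (p.w_obj a').symm.trans h
  rw [pull_cls β h ha']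
  have := carries_map (hp := hp) (A.vert β ha' φ)
  rw [p.arrow_map_vert] at this
  exact this

lemma isHom_id (x : Components p hp) : IsHom (𝟙 (base x)) := by
  obtain ⟨a, rfl⟩ := cls_surjective (hp := hp) x
  have := isHom_map (hp := hp) (𝟙 a)
  rw [p.map_id] at this
  exact this

/-- Closure under composition of the condition that the vertical part of an arrow carries its source
to the reindexing of its target. By `FibCat.vert_comp` the vertical part of a composite has three
factors; the second is carried along because reindexing in `A` lifts reindexing in `C`, the third
because the comparison of chosen lifts in `A` lifts the one in `C`. -/
lemma Carries.vert_comp {R S S' : B} (β : R ⟶ S) (β' : S ⟶ S') {x : Components p hp} {c : C.obj}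
    {a₂ a₃ : A.obj} (h₂ : A.p.obj a₂ = S) (h₃ : A.p.obj a₃ = S') (γ : c ⟶ p.obj a₂)
    (δ : p.obj a₂ ⟶ p.obj a₃) [C.p.IsHomLift β γ] [C.p.IsHomLift β' δ]
    (Hγ : Carries (Arrow.mk (C.vert β (p.obj_over h₂) γ)) x (cls hp (A.pull β h₂)))
    (Hδ : Carries (Arrow.mk (C.vert β' (p.obj_over h₃) δ)) (cls hp a₂)
      (cls hp (A.pull β' h₃))) :
    Carries (Arrow.mk (C.vert (β ≫ β') (p.obj_over h₃) (γ ≫ δ))) x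
      (cls hp (A.pull (β ≫ β') h₃)) := by
  obtain ⟨w, ψ, hw, eψ⟩ := Hδ.exists_hom (C.vert_isHomLift β' _ δ)
  have iψ : A.p.IsHomLift (𝟙 S) ψ := isHomLift_of_arrow inferInstance eψ
  have hwo := IsHomLift.codomain_eq A.p (𝟙 S) ψ
  have Hn : Carries (Arrow.mk (C.vert β (C.pull_over β' (p.obj_over h₃))
      (C.lift β (p.obj_over h₂) ≫ C.vert β' (p.obj_over h₃) δ))) (cls hp (A.pull β h₂))
      (cls hp (A.pull β (A.pull_over β' h₃))) := by
    have := carries_map (hp := hp) (A.vert β hwo (A.lift β h₂ ≫ ψ))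
    rw [cls_pull_eq β hw hwo (A.pull_over β' h₃), p.arrow_map_vert] at this
    refine Eq.mp (congrArg (fun f => Carries f _ _) ?_) this
    refine C.arrow_vert_congr β _ _ _ _ ?_
    rw [p.map_comp]
    exact arrow_comp_congr (p.arrow_map_lift β h₂) eψ
  have Hk : Carries (Arrow.mk (C.vert (β ≫ β') (p.obj_over h₃)
      (C.lift β (C.pull_over β' (p.obj_over h₃)) ≫ C.lift β' (p.obj_over h₃))))
      (cls hp (A.pull β (A.pull_over β' h₃))) (cls hp (A.pull (β ≫ β') h₃)) := by
    have := carries_map (hp := hp)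
      (A.vert (β ≫ β') h₃ (A.lift β (A.pull_over β' h₃) ≫ A.lift β' h₃))
    rw [p.arrow_map_vert] at this
    refine Eq.mp (congrArg (fun f => Carries f _ _) ?_) this
    refine C.arrow_vert_congr (β ≫ β') _ _ _ _ ?_
    rw [p.map_comp]
    exact arrow_comp_congr ((p.arrow_map_lift β _).trans
      (C.arrow_lift_congr β (p.obj_pull β' h₃) _ _)) (p.arrow_map_lift β' h₃)
  rw [C.vert_comp β β' (p.obj_over h₂) (p.obj_over h₃)]
  exact Hγ.trans (Hn.trans Hk (C.vert_isHomLift (β ≫ β') _ _))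
    (IsHomLift.comp_lift_id_right C.p (𝟙 R) _ _)

lemma IsHom.comp {x y z : Components p hp} {γ : base x ⟶ base y} {δ : base y ⟶ base z}
    (hγ : IsHom γ) (hδ : IsHom δ) : IsHom (γ ≫ δ) := by
  obtain ⟨a₂, rfl⟩ := cls_surjective y
  obtain ⟨a₃, rfl⟩ := cls_surjective z
  generalize hβ : C.p.map γ = β
  generalize hβ' : C.p.map δ = β'
  have iγ : C.p.IsHomLift β γ := hβ ▸ inferInstance
  have iδ : C.p.IsHomLift β' δ := hβ' ▸ inferInstance
  have h₂ : A.p.obj a₂ = C.p.obj (base (cls hp a₂)) := (p.w_obj a₂).symm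
  have h₃ : A.p.obj a₃ = C.p.obj (base (cls hp a₃)) := (p.w_obj a₃).symm
  have Hγ := hγ.carries_vert β rfl
  have Hδ := hδ.carries_vert β' rfl
  rw [pull_cls β rfl h₂] at Hγ
  rw [pull_cls β' rfl h₃] at Hδ
  refine IsHom.of (β ≫ β') rfl ?_
  rw [pull_cls (β ≫ β') rfl h₃]
  exact @Carries.vert_comp _ _ _ _ _ _ _ _ _ β β' x _ a₂ a₃ h₂ h₃ γ δ iγ iδ Hγ Hδ

/-- An arrow of `C` over an identity underlies an arrow of the fibration of components exactly if it
carries the source to the target. -/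
lemma IsHom.carries {x y : Components p hp} {γ : base x ⟶ base y} (hγ : IsHom γ) {b : B}
    (i : C.p.IsHomLift (𝟙 b) γ) : Carries (Arrow.mk γ) x y := by
  obtain ⟨a, rfl⟩ := cls_surjective y
  have h := IsHomLift.codomain_eq C.p (𝟙 b) γ
  have ha : A.p.obj a = b := (p.w_obj a).symm.trans h
  have H := hγ.carries_vert (𝟙 b) h
  rw [pull_cls (𝟙 b) h ha] at H
  have H' := carries_map (hp := hp) (A.lift (𝟙 b) ha)
  rw [p.arrow_map_lift] at H'
  have := H.trans H' (C.isStronglyCartesian_lift (𝟙 b) _).toIsHomLift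
  exact Eq.mp (congrArg (fun f => Carries (Arrow.mk f) x (cls hp a))
    (C.vert_lift (𝟙 b) h γ)) this

instance : Category.{v₂} (Components p hp) where
  Hom x y := { γ : base x ⟶ base y // IsHom γ }
  id x := ⟨𝟙 _, isHom_id x⟩
  comp γ δ := ⟨γ.1 ≫ δ.1, γ.2.comp δ.2⟩
  id_comp _ := Subtype.ext (Category.id_comp _)
  comp_id _ := Subtype.ext (Category.comp_id _)
  assoc _ _ _ := Subtype.ext (Category.assoc _ _ _)

lemma arrow_ext {x y x' y' : Components p hp} {γ : x ⟶ y} {γ' : x' ⟶ y'} (hx : x = x')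
    (hy : y = y') (h : Arrow.mk γ.1 = Arrow.mk γ'.1) : Arrow.mk γ = Arrow.mk γ' := by
  subst hx hy
  exact congrArg Arrow.mk (Subtype.ext ((Arrow.mk_inj _ _).1 h))

/-- The projection of components to `C`. -/
def baseFunctor (hp : IsFibrewiseOpfibration p) : Components p hp ⥤ C.obj where
  obj x := base x
  map γ := γ.1

/-- The quotient functor. -/
def clsFunctor (hp : IsFibrewiseOpfibration p) : A.obj ⥤ Components p hp where
  obj a := cls hp a
  map φ := ⟨p.map φ, isHom_map φ⟩
  map_id _ := Subtype.ext (p.map_id _)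
  map_comp _ _ := Subtype.ext (p.map_comp _ _)

lemma isHomLift_iff {x y : Components p hp} {R S : B} (β : R ⟶ S) (γ : x ⟶ y) :
    (baseFunctor hp ⋙ C.p).IsHomLift β γ ↔ C.p.IsHomLift β γ.1 := by
  rw [isHomLift_iff_arrow, isHomLift_iff_arrow]
  rfl

/-- The chosen lift to the fibration of components. -/
noncomputable def lift {R S : B} (β : R ⟶ S) {x : Components p hp}
    (h : C.p.obj (base x) = S) : pull β h ⟶ x :=
  ⟨eqToHom (base_pull β h) ≫ C.lift β h, by
    have i : C.p.IsHomLift (𝟙 R) (eqToHom (base_pull β h)) :=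
      IsHomLift.eqToHom_codomain_lift_id _ (C.pull_over β h)
    refine IsHom.of β h ?_
    rw [← C.vert_uniq β h _ (eqToHom (base_pull β h)) rfl]
    exact carries_eqToHom _ _⟩

/-- The chosen lift is strongly cartesian. -/
lemma existsUnique_lift {R R' S : B} (β : R ⟶ S) {x : Components p hp}
    (h : C.p.obj (base x) = S) (g : R' ⟶ R) {y : Components p hp} (δ : y ⟶ x)
    (hδ : C.p.IsHomLift (g ≫ β) δ.1) :
    ∃! χ : y ⟶ pull β h, C.p.IsHomLift g χ.1 ∧ χ ≫ lift β h = δ := by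
  obtain ⟨a, rfl⟩ := cls_surjective (hp := hp) x
  have ha : A.p.obj a = S := (p.w_obj a).symm.trans h
  have hP := C.pull_over β h
  have H := δ.2.carries_vert (g ≫ β) h
  rw [pull_cls (g ≫ β) h ha] at H
  -- The comparison of the chosen lift of a composite with the composite of the chosen lifts.
  let l := IsStronglyCartesian.map A.p β (A.lift β ha) (g := g) rfl (A.lift (g ≫ β) ha)
  have il : A.p.IsHomLift g l := IsStronglyCartesian.map_isHomLift A.p β (A.lift β ha) rfl _
  have hl : l ≫ A.lift β ha = A.lift (g ≫ β) ha := IsStronglyCartesian.fac A.p β _ rfl _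
  let k := A.vert g (A.pull_over β ha) l
  have hk : k ≫ A.lift g (A.pull_over β ha) ≫ A.lift β ha = A.lift (g ≫ β) ha := by
    rw [← hl]
    exact vert_lift_assoc _ _ _ _
  have e₁ : C.pull (g ≫ β) h = p.obj (A.pull (g ≫ β) ha) := (p.obj_pull (g ≫ β) ha).symm
  have e₂ : p.obj (A.pull g (A.pull_over β ha)) = C.pull g hP :=
    (p.obj_pull g (A.pull_over β ha)).trans (C.pull_congr g (p.obj_pull β ha) _ _)
  have ik : C.p.IsHomLift (𝟙 R') (p.map k) := p.map_isHomLift inferInstance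
  let k' : C.pull (g ≫ β) h ⟶ C.pull g hP := eqToHom e₁ ≫ p.map k ≫ eqToHom e₂
  have ik' : C.p.IsHomLift (𝟙 R') k' := inferInstance
  have hk' : k' ≫ C.lift g hP ≫ C.lift β h = C.lift (g ≫ β) h := by
    rw [← Arrow.mk_inj]
    refine (arrow_comp_congr (arrow_conj _ _ _) (arrow_comp_congr
      ((C.arrow_lift_congr g (p.obj_pull β ha).symm _ _).trans
        (p.arrow_map_lift g (A.pull_over β ha)).symm) (p.arrow_map_lift β ha).symm)).trans ?_
    rw [← p.map_comp, ← p.map_comp, hk]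
    exact p.arrow_map_lift (g ≫ β) ha
  have Hk' : Carries (Arrow.mk k') (cls hp (A.pull (g ≫ β) ha))
      (cls hp (A.pull g (A.pull_over β ha))) := by
    rw [arrow_conj]
    exact carries_map k
  let v := C.vert (g ≫ β) h δ.1 ≫ k'
  have iv : C.p.IsHomLift (𝟙 R') v := inferInstance
  have Hv := H.trans Hk' ik'
  let m := (v ≫ C.lift g hP) ≫ eqToHom (base_pull β h).symm
  have im : C.p.IsHomLift g m := inferInstance
  have hb : C.p.obj (base (pull β h)) = R := by rw [base_pull, hP]
  have hm : IsHom m := by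
    refine IsHom.of g hb ?_
    have e : Arrow.mk (C.vert g hb m) = Arrow.mk v := by
      rw [C.vert_uniq g hP (v ≫ C.lift g hP) v rfl]
      exact C.arrow_vert_congr g _ _ _ _ (Arrow.arrow_mk_comp_eqToHom _ _)
    have e' : pull g hb = cls hp (A.pull g (A.pull_over β ha)) := by
      have gen : ∀ {x x' : Components p hp} (_ : x = x') (h : C.p.obj (base x) = R)
          (h' : C.p.obj (base x') = R), pull g h = pull g h' := by
        rintro x x' rfl h h'
        rfl
      have hpm := pull_cls (hp := hp) β h ha
      rw [gen hpm hb (p.obj_over (A.pull_over β ha))]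
      exact pull_cls g _ _
    rw [e, e']
    exact Hv
  have hmδ : m ≫ eqToHom (base_pull β h) ≫ C.lift β h = δ.1 := by
    simp only [m, v, Category.assoc, eqToHom_trans_assoc, eqToHom_refl, Category.id_comp, hk',
      vert_lift]
  refine ⟨⟨m, hm⟩, ⟨im, Subtype.ext hmδ⟩, ?_⟩
  rintro χ ⟨hχ, e⟩
  refine Subtype.ext ?_
  have e' : χ.1 ≫ eqToHom (base_pull β h) ≫ C.lift β h = δ.1 := congrArg Subtype.val e
  have i₁ : C.p.IsHomLift g (χ.1 ≫ eqToHom (base_pull β h)) := inferInstance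
  have i₂ : C.p.IsHomLift g (m ≫ eqToHom (base_pull β h)) := inferInstance
  have : χ.1 ≫ eqToHom (base_pull β h) = m ≫ eqToHom (base_pull β h) := by
    refine IsStronglyCartesian.ext C.p β (C.lift β h) g ?_
    rw [Category.assoc, Category.assoc, e', hmδ]
  exact (cancel_mono _).1 this

end Components

open Components

/-- The fibration of components of a fibrewise opfibration `p`. Its fibre over `b` is the category
of elements of the functor that sends an object of `C_b` to the set of connected components of
the fibre of `p_b`. -/
noncomputable abbrev components (p : Hom A C) (hp : IsFibrewiseOpfibration p) :
    FibCat.{v₁, u₁, v₂, u₂} B where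
  toBasedCategory := BasedCategory.ofFunctor (baseFunctor hp ⋙ C.p)
  pull := fun {_ _} β {x} h =>
    Components.pull β (x := x) (show C.p.obj (base x) = _ from h)
  lift := fun {_ _} β {x} h =>
    Components.lift β (x := x) (show C.p.obj (base x) = _ from h)
  isStronglyCartesian_lift {R S} β x h :=
    { toIsHomLift := (isHomLift_iff β _).2
        (IsHomLift.comp_eqToHom_lift C.p β (C.lift β (show C.p.obj (base x) = S from h)) _)
      universal_property' := by
        intro y g δ hδ
        obtain ⟨χ, ⟨h₁, h₂⟩, h₃⟩ := existsUnique_lift β (x := x) h g δ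
          ((isHomLift_iff _ _).1 hδ)
        exact ⟨χ, ⟨(isHomLift_iff _ _).2 h₁, h₂⟩, fun χ' h' =>
          h₃ χ' ⟨(isHomLift_iff _ _).1 h'.1, h'.2⟩⟩ }

/-- The quotient morphism to the fibration of components. -/
noncomputable def toComponents (p : Hom A C) (hp : IsFibrewiseOpfibration p) :
    Hom A (components p hp) :=
  Hom.ofFunctor (C := components p hp) (clsFunctor hp) p.w fun β _ ha h' =>
    Components.arrow_ext (pull_cls β h' ha).symm rfl
      ((p.arrow_map_lift β ha).trans (Arrow.arrow_mk_eqToHom_comp _ _).symm)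

/-- The projection of the fibration of components. -/
noncomputable def fromComponents (p : Hom A C) (hp : IsFibrewiseOpfibration p) :
    Hom (components p hp) C :=
  Hom.ofFunctor (A := components p hp) (baseFunctor hp) rfl fun _ _ _ _ =>
    Arrow.arrow_mk_eqToHom_comp _ _

lemma toComponents_surjective (hp : IsFibrewiseOpfibration p) :
    Function.Surjective (toComponents p hp).obj :=
  cls_surjective (hp := hp)

lemma isFibrewiseDiscreteOpfibration_fromComponents (hp : IsFibrewiseOpfibration p) :
    IsFibrewiseDiscreteOpfibration (fromComponents p hp) := by
  rintro b ⟨x, hx⟩ d f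
  obtain ⟨a, rfl⟩ := cls_surjective (hp := hp) x
  have ha : A.p.obj a = b := (p.w_obj a).symm.trans hx
  obtain ⟨w, φ, hφ⟩ := exists_lift hp f.2 (a := a) rfl
  have i := isHomLift_of_arrow f.2 hφ
  refine ⟨⟨(fiberFunctor (toComponents p hp) b).obj
      (Fiber.mk (IsHomLift.codomain_eq A.p (𝟙 b) φ)),
    (fiberFunctor (toComponents p hp) b).map (fiberHomMk φ i)⟩,
    (isHomLift_iff_arrow _ _ _).2 ((arrow_fiber_iff _ _).2 hφ), ?_⟩
  rintro ⟨⟨y, hy⟩, m, hm⟩ h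
  have hm' : Arrow.mk m.1 = Arrow.mk f.1 :=
    (arrow_fiber_iff _ _).1 ((isHomLift_iff_arrow _ _ _).1 h)
  have im : C.p.IsHomLift (𝟙 b) m.1 := (isHomLift_iff _ m).1 hm
  have H := m.2.carries im
  rw [hm'] at H
  have H' : Carries (Arrow.mk f.1) (cls hp a) (cls hp w) := ⟨a, w, φ, rfl, rfl, hφ⟩
  obtain rfl := H.unique H' f.2
  refine Sigma.ext rfl (heq_of_eq (Subtype.ext (Subtype.ext ((Arrow.mk_inj _ _).1 ?_))))
  exact hm'.trans hφ.symm

/-- On every fibre, the fibration of components is the quotient of the fibres of `p_b` by their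
components. -/
lemma isComponentFactorization (hp : IsFibrewiseOpfibration p) (b : B) :
    IsComponentFactorization (fiberFunctor p b) (fiberFunctor (toComponents p hp) b)
      (fiberFunctor (fromComponents p hp) b) where
  fac := rfl
  isOpfibration := hp b
  isDiscreteOpfibration := isFibrewiseDiscreteOpfibration_fromComponents hp b
  surjective := by
    rintro ⟨x, hx⟩
    obtain ⟨a, rfl⟩ := cls_surjective (hp := hp) x
    exact ⟨⟨a, (p.w_obj a).symm.trans hx⟩, rfl⟩
  eqvGen {a a'} h := eqvGen_fiber (hp := hp) (congrArg Subtype.val h) a.2 a'.2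

end

end FibCat

theorem mainTheorem2 {B : Type u₁} [Category.{v₁} B]
    {A C : FibCat.{v₁, u₁, v₂, max u₂ v₂} B} (p : A ⟶ C)
    (hp : FibCat.IsFibrewiseOpfibration p) :
    ∃ (K : FibCat.{v₁, u₁, v₂, max u₂ v₂} B) (k₀ k₁ : K ⟶ A) (κ : k₀ ⟶ k₁)
      (Q : FibCat.{v₁, u₁, v₂, max u₂ v₂} B) (q : A ⟶ Q) (s : Q ⟶ C),
      q ≫ s = p ∧
      TwoCat.IsIdentee p κ ∧
      TwoCat.IsCoidentifier κ q ∧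
      TwoCat.IsInitial q ∧
      TwoCat.IsDiscreteOpfibration s ∧
      FibCat.IsFibrewiseDiscreteOpfibration s ∧
      (∀ b : B,
        TwoCat.IsIdentee (FibCat.fiberHom p b) (FibCat.fiberHom₂ κ b) ∧
        TwoCat.IsCoidentifier (FibCat.fiberHom₂ κ b) (FibCat.fiberHom q b) ∧
        (FibCat.fiberFunctor q b).Initial) ∧
      (∀ {b' b : B} (β : b' ⟶ b),
        FibCat.fiberFunctor q b ⋙ Q.reindex β = A.reindex β ⋙ FibCat.fiberFunctor q b' ∧
        FibCat.fiberFunctor s b ⋙ C.reindex β = Q.reindex β ⋙ FibCat.fiberFunctor s b') := by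
  have hs := FibCat.isFibrewiseDiscreteOpfibration_fromComponents hp
  have hF := FibCat.isComponentFactorization hp
  have hcoid : ∀ b, TwoCat.IsCoidentifier (FibCat.fiberHom₂ (FibCat.identeeCell p) b)
      (FibCat.fiberHom (FibCat.toComponents p hp) b) := fun b =>
    (hF b).isCoidentifier _
      (fun K => (FibCat.isEqToHom_fiber_iff _).2 K.1.isEqToHom)
      (fun {a a'} φ hφ => ⟨⟨⟨a.1, a'.1, φ.1, (FibCat.isEqToHom_fiber_iff _).1 hφ⟩, a.2⟩,
        (FibCat.arrow_fiber_iff _ _).2 rfl⟩)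
  have hq : TwoCat.IsCoidentifier (C := FibCat.{v₁, u₁, v₂, max u₂ v₂} B) (FibCat.identeeCell p)
      (FibCat.toComponents p hp) := by
    refine FibCat.isCoidentifier_of_fiber (FibCat.toComponents_surjective hp) ?_ hcoid
    refine (FibCat.isIdentity_iff _).2 fun K => ?_
    exact (FibCat.isEqToHom_fiber_iff _).1 ((hF (A.p.obj K.src)).isEqToHom_map
      (FibCat.fiberHomMk K.hom (FibCat.Hom.vertical p K.isEqToHom rfl))
      ((FibCat.isEqToHom_fiber_iff _).2 K.isEqToHom))
  exact ⟨FibCat.identee p, FibCat.identeeSrc p, FibCat.identeeTgt p, FibCat.identeeCell p,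
    FibCat.components p hp, FibCat.toComponents p hp, FibCat.fromComponents p hp,
    FibCat.Hom.ext_functor rfl, FibCat.isIdentee_identeeCell p, hq, hq.isInitial,
    hs.isDiscreteOpfibration, hs,
    fun b => ⟨FibCat.isIdentee_fiberHom₂_identeeCell p b, hcoid b, (hF b).initial⟩,
    fun β => ⟨FibCat.fiberFunctor_comp_reindex _ β, FibCat.fiberFunctor_comp_reindex _ β⟩⟩
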